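/- Let $\mathbbm{k}$ be an algebraically closed field of characteristic zero, and let $M=\bigoplus_{n\ge 0}M(n)$ be a finite-dimensional graded pointed Majid algebra (coquasi-Hopf algebra) over $\mathbbm{k}$, with comultiplication $\Delta(a)=a_1\otimes a_2$, counit $\varepsilon$, associator $\Phi$ and antipode $(S,\alpha,\beta)$, generated by an abelian group $G$, the group of all group-like elements of $M$, and a set of skew-primitive elements. Here the associator is normalized so that $a_1(b_1c_1)\,\Phi(a_2,b_2,c_2)=\Phi(a_1,b_1,c_1)\,(a_2b_2)c_2$; graded means that $\bigoplus_{i\le n}M(i)$ is the $n$-th term of the coradical filtration and that the coalgebra structure, the multiplication, the associator and the antipode respect the grading (so $\Phi$, $\alpha$, $\beta$ vanish on homogeneous arguments of positive total degree). Thus $M(0)=\mathbbm{k}G$, the restriction of $\Phi$ to $G$ is a normalized $3$-cocycle, and the antipode is taken normalized by $\alpha(g)=1$ for $g\in G$, so that $S(g)=g^{-1}$ and $\beta(g)=\Phi(g,g^{-1},g)^{-1}$. Let $\pi:M\to M(0)=\mathbbm{k}G$ be the canonical projection, and let $$R=\{X\in M\mid (\operatorname{id}\otimes\pi)\Delta(X)=X\otimes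 1\}$$ be the coinvariant subalgebra. Let ${}^{\mathbbm{k}G}_{\mathbbm{k}G}\mathcal{YD}^{\Phi}$ be the braided tensor category whose objects are the spaces $V=\bigoplus_{g\in G}V_g$ with linear maps $f\triangleright-:V_g\to V_g$ $(f,g\in G)$ such that $1\triangleright v=v$ and $e\triangleright(f\triangleright v)=\widetilde\Phi_g(e,f)\,(ef)\triangleright v$ for $v\in V_g$, where $\widetilde\Phi_g(e,f)=\frac{\Phi(g,e,f)\Phi(e,f,g)}{\Phi(e,g,f)}$; whose morphisms are the graded linear maps commuting with $\triangleright$; whose tensor product is $V\otimes W$ with $(V\otimes W)_g=\bigoplus_{ef=g}V_e\otimes W_f$ and $g\triangleright(v\otimes w)=\frac{\Phi(g,e,f)\Phi(e,f,g)}{\Phi(e,g,f)}(g\triangleright v)\otimes(g\triangleright w)$ for $v\in V_e$, $w\in W_f$; whose unit object is $\mathbbm{k}$ in degree $1$ with trivial action and the usual unit constraints; and whose associativity constraint and braiding are $(u\otimes v)\otimes w\mapsto\Phi(e,f,g)^{-1}u\otimes(v\otimes w)$ and $u\otimes v\mapsto (e\triangleright v)\otimes u$ for $u,v,w$ of degrees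 $e,f,g$. **Proposition.** The space $R$ is an object of ${}^{\mathbbm{k}G}_{\mathbbm{k}G}\mathcal{YD}^{\Phi}$ with $R_g=\{X\in R\mid(\pi\otimes\operatorname{id})\Delta(X)=g\otimes X\}$ and $$f\triangleright X=\frac{\Phi(fg,f^{-1},f)}{\Phi(f,f^{-1},f)}\,(f\cdot X)\cdot f^{-1}\qquad(f\in G,\ X\in R_g),$$ and it is a Hopf algebra in this braided tensor category, in which 1. the multiplication and the unit are inherited from those of $M$; 2. the comultiplication is $\Delta_R(X)=\Phi(x_1,x_2,x_2^{-1})\,X_1\cdot x_2^{-1}\otimes X_2$, where $\Delta(X)=X_1\otimes X_2$ in $M$ is written (as is always possible) with $X_2\in R$ homogeneous of degree $x_2$ and $X_1$ such that $(\pi\otimes\operatorname{id})\Delta(X_1)=x_1x_2\otimes X_1$ and $(\operatorname{id}\otimes\pi)\Delta(X_1)=X_1\otimes x_2$ (so $X_1\cdot x_2^{-1}\in R$ has degree $x_1$); 3. the counit is $\varepsilon_R=\varepsilon|_R$; 4. the antipode is $S_R(X)=\Phi(x,x^{-1},x)^{-1}\,x\cdot S(X)$ for $X\in R$ homogeneous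 of degree $x$. -/

import Mathlib

set_option linter.unusedVariables false

open CategoryTheory MonoidalCategory
open scoped TensorProduct

/-- A normalized 3-cocycle on the group `G` with values in the multiplicative group of `k`. -/
structure ThreeCocycle (G k : Type*) [Group G] [Field k] where
  toFun : G → G → G → kˣ
  cocycle : ∀ e f g h, toFun (e * f) g h * toFun e f (g * h) =
    toFun e f g * toFun e (f * g) h * toFun f g h
  normalized : ∀ f g, toFun f 1 g = 1

namespace ThreeCocycle

instance {G k : Type*} [Group G] [Field k] :
    CoeFun (ThreeCocycle G k) (fun _ => G → G → G → kˣ) := ⟨toFun⟩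

section
variable {G k : Type*} [CommGroup G] [Field k] (φ : ThreeCocycle G k)

/-- `Φ̃_g(x, y) = Φ(g, x, y) Φ(x, y, g) / Φ(x, g, y)`. -/
def tw (g x y : G) : kˣ := φ g x y * φ x y g / φ x g y

theorem one_left (f g : G) : φ 1 f g = 1 := by
  have h := φ.cocycle 1 1 f g
  have h1 := φ.normalized 1 (f * g)
  have h2 := φ.normalized 1 g
  have h3 := φ.normalized 1 f
  simp only [one_mul, h1, h3, mul_one] at h
  simpa using h

theorem one_right (f g : G) : φ f g 1 = 1 := by
  have h := φ.cocycle f g 1 1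
  simp only [mul_one, φ.normalized, one_mul] at h
  simpa using h

theorem tw_one_mid (g y : G) : φ.tw g 1 y = 1 := by
  simp [tw, one_left, φ.normalized]

theorem tw_one_right (g y : G) : φ.tw g y 1 = 1 := by
  simp [tw, one_right, φ.normalized]

theorem tw_one_left (x y : G) : φ.tw 1 x y = 1 := by
  simp [tw, one_left, one_right, φ.normalized]

private theorem add_cocycle (e f g h : G) :
    Additive.ofMul (φ (e * f) g h) + Additive.ofMul (φ e f (g * h)) =
    Additive.ofMul (φ e f g) + Additive.ofMul (φ e (f * g) h) + Additive.ofMul (φ f g h) := by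
  simpa only [← ofMul_mul] using congrArg Additive.ofMul (φ.cocycle e f g h)

theorem tw_cocycle (g x y z : G) :
    φ.tw g x y * φ.tw g (x * y) z = φ.tw g y z * φ.tw g x (y * z) := by
  have h1 := φ.add_cocycle g x y z
  have h2 := φ.add_cocycle x g y z
  have h3 := φ.add_cocycle x y g z
  have h4 := φ.add_cocycle x y z g
  apply Additive.ofMul.injective
  simp only [tw, ofMul_mul, ofMul_div]
  rw [mul_comm x g] at h2
  rw [mul_comm y g] at h3
  rw [mul_comm z g] at h4
  linear_combination (norm := abel) -h1 + h2 - h3 + h4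

theorem tw_mul (a b e h : G) :
    φ.tw b e h * φ.tw a e h * φ.tw e a b * φ.tw h a b = φ.tw (e * h) a b * φ.tw (a * b) e h := by
  have h1 := φ.add_cocycle a b e h
  have h2 := φ.add_cocycle a e b h
  have h3 := φ.add_cocycle e a b h
  have h4 := φ.add_cocycle a e h b
  have h5 := φ.add_cocycle e a h b
  have h6 := φ.add_cocycle e h a b
  apply Additive.ofMul.injective
  simp only [tw, ofMul_mul, ofMul_div]
  rw [mul_comm e b, mul_comm e a] at *
  rw [mul_comm h b, mul_comm h a] at *
  linear_combination (norm := abel) -h1 + h2 - h3 - h4 + h5 - h6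

theorem tw_assoc (f x y z : G) :
    φ.tw f (x * y) z * φ.tw f x y * (φ x y z)⁻¹ =
    (φ x y z)⁻¹ * φ.tw f x (y * z) * φ.tw f y z := by
  have := φ.tw_cocycle f x y z
  rw [mul_comm _ (φ x y z)⁻¹, mul_assoc, mul_comm (φ.tw f (x * y) z), this,
    mul_comm (φ.tw f y z)]

theorem tw_comm (f e h : G) : φ.tw f h e * φ.tw h f e = φ.tw f e h * φ.tw h e f := by
  apply Additive.ofMul.injective
  simp only [tw, ofMul_mul, ofMul_div]
  abel

theorem tw_inv_comm (g e : G) : φ.tw g e⁻¹ e = φ.tw g e e⁻¹ := by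
  have h := φ.tw_cocycle g e e⁻¹ e
  simpa [tw_one_mid, tw_one_right] using h.symm

end
end ThreeCocycle

/-- The structure of an object of the Yetter-Drinfeld category of `(kG, Φ)` on a vector space `V`
(`G` a finite abelian group).  The grading `V = ⨁ V_g` is given by its family of
projections `proj g : V → V_g ⊆ V` (the action of `δ_g 1`), and `act f` is `f ▷ _`, which makes
`V_g` a projective representation with respect to the 2-cocycle `Φ̃_g`. -/
structure YDModule {G k : Type*} [CommGroup G] [Fintype G] [DecidableEq G] [Field k]
    (φ : ThreeCocycle G k) (V : Type*) [AddCommGroup V] [Module k V] where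
  proj : G → V →ₗ[k] V
  act : G → V →ₗ[k] V
  proj_proj : ∀ g h v, proj g (proj h v) = if g = h then proj h v else 0
  sum_proj : ∀ v, ∑ g, proj g v = v
  proj_act : ∀ g f v, proj g (act f v) = act f (proj g v)
  act_one : ∀ v, act 1 v = v
  act_act : ∀ e f g v, act e (act f (proj g v)) = (φ.tw g e f : k) • act (e * f) (proj g v)

namespace YDModule

section
variable {G : Type*} {k : Type*} [CommGroup G] [Fintype G] [DecidableEq G] [Field k]
  {φ : ThreeCocycle G k} {V W U N : Type*} [AddCommGroup V] [Module k V] [AddCommGroup W]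
  [Module k W] [AddCommGroup U] [Module k U] [AddCommGroup N] [Module k N]

/-- `v` is homogeneous of degree `g`, that is `v ∈ V_g`. -/
def IsHom (Y : YDModule φ V) (g : G) (v : V) : Prop := Y.proj g v = v

variable (Y : YDModule φ V) (Z : YDModule φ W) (T : YDModule φ U)

theorem isHom_proj (g : G) (v : V) : Y.IsHom g (Y.proj g v) := by
  simp [IsHom, proj_proj]

variable {Y} {Z} {T}

theorem IsHom.proj_eq {g : G} {v : V} (h : Y.IsHom g v) (e : G) :
    Y.proj e v = if e = g then v else 0 := by
  conv_lhs => rw [← show Y.proj g v = v from h, proj_proj]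
  rw [show Y.proj g v = v from h]

theorem IsHom.act {g : G} {v : V} (h : Y.IsHom g v) (f : G) : Y.IsHom g (Y.act f v) := by
  rw [IsHom, proj_act, show Y.proj g v = v from h]

theorem IsHom.smul {g : G} {v : V} (h : Y.IsHom g v) (c : k) : Y.IsHom g (c • v) := by
  rw [IsHom, map_smul, show Y.proj g v = v from h]

theorem IsHom.act_act {g : G} {v : V} (h : Y.IsHom g v) (e f : G) :
    Y.act e (Y.act f v) = (φ.tw g e f : k) • Y.act (e * f) v := by
  have := Y.act_act e f g v
  rwa [show Y.proj g v = v from h] at this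

theorem ext_isHom (Y : YDModule φ V) {a b : V →ₗ[k] N} (h : ∀ g v, Y.IsHom g v → a v = b v) :
    a = b := by
  ext v
  rw [← Y.sum_proj v, map_sum, map_sum]
  exact Finset.sum_congr rfl fun g _ => h g _ (Y.isHom_proj g v)

theorem ext_tmul (Y : YDModule φ V) (Z : YDModule φ W) {a b : V ⊗[k] W →ₗ[k] N}
    (h : ∀ e f v w, Y.IsHom e v → Z.IsHom f w → a (v ⊗ₜ w) = b (v ⊗ₜ w)) : a = b := by
  apply TensorProduct.ext
  refine Y.ext_isHom fun e v hv => Z.ext_isHom fun f w hw => ?_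
  exact h e f v w hv hw

theorem ext_tmul₃ (Y : YDModule φ V) (Z : YDModule φ W) (T : YDModule φ U)
    {a b : (V ⊗[k] W) ⊗[k] U →ₗ[k] N}
    (h : ∀ e f g v w u, Y.IsHom e v → Z.IsHom f w → T.IsHom g u →
      a ((v ⊗ₜ w) ⊗ₜ u) = b ((v ⊗ₜ w) ⊗ₜ u)) : a = b := by
  apply TensorProduct.ext
  refine Y.ext_tmul Z fun e f v w hv hw => T.ext_isHom fun g u hu => ?_
  exact h e f g v w u hv hw hu

theorem ext_tmul₃' (Y : YDModule φ V) (Z : YDModule φ W) (T : YDModule φ U)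
    {a b : V ⊗[k] (W ⊗[k] U) →ₗ[k] N}
    (h : ∀ e f g v w u, Y.IsHom e v → Z.IsHom f w → T.IsHom g u →
      a (v ⊗ₜ (w ⊗ₜ u)) = b (v ⊗ₜ (w ⊗ₜ u))) : a = b := by
  apply TensorProduct.ext
  refine Y.ext_isHom fun e v hv => ?_
  refine Z.ext_tmul T fun f g w u hw hu => ?_
  exact h e f g v w u hv hw hu

/-- The projection of `V ⊗ W` onto the component of degree `g`, which is `⨁_{ef = g} V_e ⊗ W_f`. -/
def tensorProj (Y : YDModule φ V) (Z : YDModule φ W) (g : G) : V ⊗[k] W →ₗ[k] V ⊗[k] W :=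
  ∑ e, TensorProduct.map (Y.proj e) (Z.proj (e⁻¹ * g))

/-- The action on `V ⊗ W`: for `X ∈ V_x`, `Y ∈ W_y`,
`f ▷ (X ⊗ Y) = Φ(f, x, y) Φ(x, y, f) / Φ(x, f, y) (f ▷ X) ⊗ (f ▷ Y)`. -/
def tensorAct (Y : YDModule φ V) (Z : YDModule φ W) (f : G) : V ⊗[k] W →ₗ[k] V ⊗[k] W :=
  ∑ x, ∑ y, ((φ f x y * φ x y f / φ x f y : kˣ) : k) •
    TensorProduct.map (Y.act f ∘ₗ Y.proj x) (Z.act f ∘ₗ Z.proj y)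

theorem tensorProj_tmul {e f : G} {v : V} {w : W} (hv : Y.IsHom e v) (hw : Z.IsHom f w) (g : G) :
    Y.tensorProj Z g (v ⊗ₜ w) = if g = e * f then v ⊗ₜ w else 0 := by
  simp only [tensorProj, LinearMap.sum_apply, TensorProduct.map_tmul, hv.proj_eq, hw.proj_eq]
  rw [Finset.sum_eq_single e]
  · simp only [if_true, inv_mul_eq_iff_eq_mul]
    split_ifs <;> simp
  · intro b _ hb
    simp [hb]
  · simp

theorem tensorAct_tmul {x y : G} {v : V} {w : W} (hv : Y.IsHom x v) (hw : Z.IsHom y w) (f : G) :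
    Y.tensorAct Z f (v ⊗ₜ w) = (φ.tw f x y : k) • (Y.act f v ⊗ₜ Z.act f w) := by
  simp only [tensorAct, LinearMap.sum_apply, LinearMap.smul_apply, TensorProduct.map_tmul,
    LinearMap.comp_apply, hv.proj_eq, hw.proj_eq]
  rw [Finset.sum_eq_single x, Finset.sum_eq_single y]
  · simp [ThreeCocycle.tw]
  · intro b _ hb
    simp [hb]
  · simp
  · intro b _ hb
    simp [hb]
  · simp

/-- The tensor product of two Yetter-Drinfeld modules. -/
def tensor (Y : YDModule φ V) (Z : YDModule φ W) : YDModule φ (V ⊗[k] W) where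
  proj := Y.tensorProj Z
  act := Y.tensorAct Z
  proj_proj g h v := by
    have : Y.tensorProj Z g ∘ₗ Y.tensorProj Z h = if g = h then Y.tensorProj Z h else 0 := by
      refine Y.ext_tmul Z fun e f v w hv hw => ?_
      rw [LinearMap.comp_apply, tensorProj_tmul hv hw]
      by_cases h1 : h = e * f
      · by_cases h2 : g = h
        · simp [h1, h2, tensorProj_tmul hv hw]
        · have : g ≠ e * f := fun h' => h2 (h'.trans h1.symm)
          simp [h1, this, tensorProj_tmul hv hw]
      · by_cases h2 : g = h
        · simp [h1, h2, tensorProj_tmul hv hw]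
        · simp [h1, h2]
    have := LinearMap.congr_fun this v
    rw [LinearMap.comp_apply] at this
    rw [this]
    split_ifs <;> rfl
  sum_proj v := by
    have : ∑ g, Y.tensorProj Z g = LinearMap.id := by
      refine Y.ext_tmul Z fun e f v w hv hw => ?_
      simp [LinearMap.sum_apply, tensorProj_tmul hv hw]
    simpa [LinearMap.sum_apply] using LinearMap.congr_fun this v
  proj_act g f v := by
    refine LinearMap.congr_fun (f := Y.tensorProj Z g ∘ₗ Y.tensorAct Z f)
      (g := Y.tensorAct Z f ∘ₗ Y.tensorProj Z g) ?_ v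
    refine Y.ext_tmul Z fun x y v w hv hw => ?_
    simp only [LinearMap.comp_apply, tensorAct_tmul hv hw, map_smul,
      tensorProj_tmul (hv.act f) (hw.act f), tensorProj_tmul hv hw]
    split_ifs <;> simp [tensorAct_tmul hv hw]
  act_one v := by
    refine LinearMap.congr_fun (f := Y.tensorAct Z 1) (g := LinearMap.id) ?_ v
    refine Y.ext_tmul Z fun x y v w hv hw => ?_
    simp [tensorAct_tmul hv hw, ThreeCocycle.tw_one_left, act_one]
  act_act a b g v := by
    refine LinearMap.congr_fun
      (f := Y.tensorAct Z a ∘ₗ Y.tensorAct Z b ∘ₗ Y.tensorProj Z g)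
      (g := (φ.tw g a b : k) • (Y.tensorAct Z (a * b) ∘ₗ Y.tensorProj Z g)) ?_ v
    refine Y.ext_tmul Z fun x y v w hv hw => ?_
    simp only [LinearMap.comp_apply, LinearMap.smul_apply, tensorProj_tmul hv hw]
    split_ifs with h
    · subst h
      simp only [tensorAct_tmul hv hw, map_smul, tensorAct_tmul (hv.act b) (hw.act b),
        hv.act_act, hw.act_act, TensorProduct.smul_tmul_smul, smul_smul, ← Units.val_mul]
      rw [← φ.tw_mul a b x y]
      simp only [mul_assoc]
    · simp

theorem IsHom.tmul {e f : G} {v : V} {w : W} (hv : Y.IsHom e v) (hw : Z.IsHom f w) :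
    (Y.tensor Z).IsHom (e * f) (v ⊗ₜ w) := by
  simp [IsHom, tensor, tensorProj_tmul hv hw]

theorem tensor_act_tmul {x y : G} {v : V} {w : W} (hv : Y.IsHom x v) (hw : Z.IsHom y w) (f : G) :
    (Y.tensor Z).act f (v ⊗ₜ w) = (φ.tw f x y : k) • (Y.act f v ⊗ₜ Z.act f w) :=
  tensorAct_tmul hv hw f

variable (φ) in
/-- The unit object: `k` in degree `1` with trivial action. -/
def unit : YDModule φ k where
  proj g := if g = 1 then LinearMap.id else 0
  act _ := LinearMap.id
  proj_proj g h v := by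
    split_ifs <;> simp_all
  sum_proj v := by
    rw [Finset.sum_eq_single 1] <;> simp +contextual
  proj_act g f v := rfl
  act_one v := rfl
  act_act e f g v := by
    by_cases h : g = 1 <;> simp [h, ThreeCocycle.tw_one_left]

theorem unit_isHom (c : k) : (unit φ).IsHom 1 c := by simp [IsHom, unit]

/-- The associativity constraint:
`(X ⊗ Y) ⊗ Z ↦ Φ(e, f, g)⁻¹ X ⊗ (Y ⊗ Z)` for `X`, `Y`, `Z` of degrees `e`, `f`, `g`. -/
def assocHom (Y : YDModule φ V) (Z : YDModule φ W) (T : YDModule φ U) :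
    (V ⊗[k] W) ⊗[k] U →ₗ[k] V ⊗[k] (W ⊗[k] U) :=
  ∑ e, ∑ f, ∑ g, (((φ e f g)⁻¹ : kˣ) : k) • ((TensorProduct.assoc k V W U).toLinearMap ∘ₗ
    TensorProduct.map (TensorProduct.map (Y.proj e) (Z.proj f)) (T.proj g))

/-- The inverse of the associativity constraint. -/
def assocInv (Y : YDModule φ V) (Z : YDModule φ W) (T : YDModule φ U) :
    V ⊗[k] (W ⊗[k] U) →ₗ[k] (V ⊗[k] W) ⊗[k] U :=
  ∑ e, ∑ f, ∑ g, (φ e f g : k) • ((TensorProduct.assoc k V W U).symm.toLinearMap ∘ₗ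
    TensorProduct.map (Y.proj e) (TensorProduct.map (Z.proj f) (T.proj g)))

theorem assocHom_tmul {e f g : G} {v : V} {w : W} {u : U} (hv : Y.IsHom e v) (hw : Z.IsHom f w)
    (hu : T.IsHom g u) : assocHom Y Z T ((v ⊗ₜ w) ⊗ₜ u) =
      (((φ e f g)⁻¹ : kˣ) : k) • (v ⊗ₜ (w ⊗ₜ u)) := by
  simp only [assocHom, LinearMap.sum_apply, LinearMap.smul_apply, TensorProduct.map_tmul,
    LinearMap.comp_apply, hv.proj_eq, hw.proj_eq, hu.proj_eq, LinearEquiv.coe_coe]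
  rw [Finset.sum_eq_single e, Finset.sum_eq_single f, Finset.sum_eq_single g] <;>
  simp +contextual

theorem assocInv_tmul {e f g : G} {v : V} {w : W} {u : U} (hv : Y.IsHom e v) (hw : Z.IsHom f w)
    (hu : T.IsHom g u) : assocInv Y Z T (v ⊗ₜ (w ⊗ₜ u)) =
      (φ e f g : k) • ((v ⊗ₜ w) ⊗ₜ u) := by
  simp only [assocInv, LinearMap.sum_apply, LinearMap.smul_apply, TensorProduct.map_tmul,
    LinearMap.comp_apply, hv.proj_eq, hw.proj_eq, hu.proj_eq, LinearEquiv.coe_coe]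
  rw [Finset.sum_eq_single e, Finset.sum_eq_single f, Finset.sum_eq_single g] <;>
  simp +contextual

/-- The braiding `X ⊗ Y ↦ (e ▷ Y) ⊗ X` for `X` of degree `e`. -/
def braidHom (Y : YDModule φ V) (Z : YDModule φ W) : V ⊗[k] W →ₗ[k] W ⊗[k] V :=
  ∑ e, (TensorProduct.comm k V W).toLinearMap ∘ₗ TensorProduct.map (Y.proj e) (Z.act e)

/-- The inverse of the braiding: `Y ⊗ X ↦ X ⊗ (e ▷ _)⁻¹ Y` for `X` of degree `e`. -/
def braidInv (Y : YDModule φ V) (Z : YDModule φ W) : W ⊗[k] V →ₗ[k] V ⊗[k] W :=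
  ∑ e, ∑ g, (((φ.tw g e⁻¹ e)⁻¹ : kˣ) : k) • ((TensorProduct.comm k W V).toLinearMap ∘ₗ
    TensorProduct.map (Z.act e⁻¹ ∘ₗ Z.proj g) (Y.proj e))

theorem braidHom_tmul {e : G} {v : V} (hv : Y.IsHom e v) (w : W) :
    braidHom Y Z (v ⊗ₜ w) = Z.act e w ⊗ₜ v := by
  simp only [braidHom, LinearMap.sum_apply, TensorProduct.map_tmul,
    LinearMap.comp_apply, hv.proj_eq, LinearEquiv.coe_coe]
  rw [Finset.sum_eq_single e] <;> simp +contextual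

theorem braidInv_tmul {e g : G} {v : V} {w : W} (hv : Y.IsHom e v) (hw : Z.IsHom g w) :
    braidInv Y Z (w ⊗ₜ v) = (((φ.tw g e⁻¹ e)⁻¹ : kˣ) : k) • (v ⊗ₜ Z.act e⁻¹ w) := by
  simp only [braidInv, LinearMap.sum_apply, LinearMap.smul_apply, TensorProduct.map_tmul,
    LinearMap.comp_apply, hv.proj_eq, hw.proj_eq, LinearEquiv.coe_coe]
  rw [Finset.sum_eq_single e, Finset.sum_eq_single g] <;> simp +contextual

/-- `l` is a morphism of Yetter-Drinfeld modules: graded and commuting with the action. -/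
structure IsMor (Y : YDModule φ V) (Z : YDModule φ W) (l : V →ₗ[k] W) : Prop where
  map_proj : ∀ g v, l (Y.proj g v) = Z.proj g (l v)
  map_act : ∀ f v, l (Y.act f v) = Z.act f (l v)

theorem IsMor.isHom {l : V →ₗ[k] W} (hl : IsMor Y Z l) {g : G} {v : V} (h : Y.IsHom g v) :
    Z.IsHom g (l v) := by
  rw [IsHom, ← hl.map_proj, show Y.proj g v = v from h]

theorem isMor_of_isHom {l : V →ₗ[k] W} (h1 : ∀ g v, Y.IsHom g v → Z.IsHom g (l v))
    (h2 : ∀ f g v, Y.IsHom g v → l (Y.act f v) = Z.act f (l v)) : IsMor Y Z l where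
  map_proj g v := by
    refine LinearMap.congr_fun (f := l ∘ₗ Y.proj g) (g := Z.proj g ∘ₗ l) ?_ v
    refine Y.ext_isHom fun e v hv => ?_
    rw [LinearMap.comp_apply, LinearMap.comp_apply, hv.proj_eq, (h1 e v hv).proj_eq]
    split_ifs <;> simp
  map_act f v :=
    LinearMap.congr_fun (f := l ∘ₗ Y.act f) (g := Z.act f ∘ₗ l) (Y.ext_isHom fun e v => h2 f e v) v

theorem isMor_tensor {l : V ⊗[k] W →ₗ[k] U}
    (h1 : ∀ e f v w, Y.IsHom e v → Z.IsHom f w → T.IsHom (e * f) (l (v ⊗ₜ w)))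
    (h2 : ∀ g e f v w, Y.IsHom e v → Z.IsHom f w →
      l ((φ.tw g e f : k) • (Y.act g v ⊗ₜ Z.act g w)) = T.act g (l (v ⊗ₜ w))) :
    IsMor (Y.tensor Z) T l where
  map_proj g v := by
    refine LinearMap.congr_fun (f := l ∘ₗ Y.tensorProj Z g) (g := T.proj g ∘ₗ l) ?_ v
    refine Y.ext_tmul Z fun e f v w hv hw => ?_
    rw [LinearMap.comp_apply, LinearMap.comp_apply, tensorProj_tmul hv hw,
      (h1 e f v w hv hw).proj_eq]
    split_ifs <;> simp
  map_act g v := by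
    refine LinearMap.congr_fun (f := l ∘ₗ Y.tensorAct Z g) (g := T.act g ∘ₗ l) ?_ v
    refine Y.ext_tmul Z fun e f v w hv hw => ?_
    rw [LinearMap.comp_apply, LinearMap.comp_apply, tensorAct_tmul hv hw, h2 g e f v w hv hw]

theorem IsMor.symm {l : V →ₗ[k] W} {l' : W →ₗ[k] V} (hl : IsMor Y Z l)
    (h1 : l' ∘ₗ l = LinearMap.id) (h2 : l ∘ₗ l' = LinearMap.id) : IsMor Z Y l' where
  map_proj g v := by
    have e1 := LinearMap.congr_fun h1
    have e2 := LinearMap.congr_fun h2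
    simp only [LinearMap.comp_apply, LinearMap.id_apply] at e1 e2
    rw [← e1 (Y.proj g (l' v)), hl.map_proj, e2]
  map_act g v := by
    have e1 := LinearMap.congr_fun h1
    have e2 := LinearMap.congr_fun h2
    simp only [LinearMap.comp_apply, LinearMap.id_apply] at e1 e2
    rw [← e1 (Y.act g (l' v)), hl.map_act, e2]

theorem IsMor.tensor {V' W' : Type*} [AddCommGroup V'] [Module k V'] [AddCommGroup W']
    [Module k W'] {Y' : YDModule φ V'} {Z' : YDModule φ W'} {l : V →ₗ[k] V'} {m : W →ₗ[k] W'}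
    (hl : IsMor Y Y' l) (hm : IsMor Z Z' m) :
    IsMor (Y.tensor Z) (Y'.tensor Z') (TensorProduct.map l m) := by
  refine isMor_tensor (fun e f v w hv hw => ?_) (fun g e f v w hv hw => ?_)
  · exact (hl.isHom hv).tmul (hm.isHom hw)
  · simp only [TensorProduct.map_tmul, map_smul, hl.map_act, hm.map_act,
      tensor_act_tmul (hl.isHom hv) (hm.isHom hw)]

theorem assocInv_comp_assocHom : assocInv Y Z T ∘ₗ assocHom Y Z T = LinearMap.id := by
  refine Y.ext_tmul₃ Z T fun x y z a b c ha hb hc => ?_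
  simp [assocHom_tmul ha hb hc, assocInv_tmul ha hb hc]

theorem assocHom_comp_assocInv : assocHom Y Z T ∘ₗ assocInv Y Z T = LinearMap.id := by
  refine Y.ext_tmul₃' Z T fun x y z a b c ha hb hc => ?_
  simp [assocHom_tmul ha hb hc, assocInv_tmul ha hb hc]

theorem isMor_assocHom : IsMor ((Y.tensor Z).tensor T) (Y.tensor (Z.tensor T))
    (assocHom Y Z T) where
  map_proj g t := by
    refine LinearMap.congr_fun (f := assocHom Y Z T ∘ₗ (Y.tensor Z).tensorProj T g)
      (g := Y.tensorProj (Z.tensor T) g ∘ₗ assocHom Y Z T) ?_ t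
    refine Y.ext_tmul₃ Z T fun x y z a b c ha hb hc => ?_
    simp only [LinearMap.comp_apply, tensorProj_tmul (ha.tmul hb) hc,
      assocHom_tmul ha hb hc, map_smul, tensorProj_tmul ha (hb.tmul hc), mul_assoc]
    split_ifs <;> simp [assocHom_tmul ha hb hc]
  map_act f t := by
    refine LinearMap.congr_fun (f := assocHom Y Z T ∘ₗ (Y.tensor Z).tensorAct T f)
      (g := Y.tensorAct (Z.tensor T) f ∘ₗ assocHom Y Z T) ?_ t
    refine Y.ext_tmul₃ Z T fun x y z a b c ha hb hc => ?_
    simp only [LinearMap.comp_apply, tensorAct_tmul (ha.tmul hb) hc, tensor_act_tmul ha hb,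
      ← TensorProduct.smul_tmul', map_smul,
      assocHom_tmul (ha.act f) (hb.act f) (hc.act f), assocHom_tmul ha hb hc,
      tensorAct_tmul ha (hb.tmul hc), tensor_act_tmul hb hc, TensorProduct.tmul_smul,
      smul_smul, ← Units.val_mul]
    rw [φ.tw_assoc]
    simp only [mul_assoc]

theorem braidInv_comp_braidHom : braidInv Y Z ∘ₗ braidHom Y Z = LinearMap.id := by
  refine Y.ext_tmul Z fun x y a b ha hb => ?_
  simp [braidHom_tmul ha, braidInv_tmul ha (hb.act x), hb.act_act, act_one]

theorem braidHom_comp_braidInv : braidHom Y Z ∘ₗ braidInv Y Z = LinearMap.id := by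
  refine Z.ext_tmul Y fun y x b a hb ha => ?_
  simp [braidInv_tmul ha hb, braidHom_tmul ha, hb.act_act, act_one, ← TensorProduct.smul_tmul',
    φ.tw_inv_comm, smul_smul]

theorem isMor_braidHom : IsMor (Y.tensor Z) (Z.tensor Y) (braidHom Y Z) := by
  refine isMor_tensor (fun e f v w hv hw => ?_) (fun g e f v w hv hw => ?_)
  · rw [braidHom_tmul hv, mul_comm]
    exact (hw.act e).tmul hv
  · rw [map_smul, braidHom_tmul (hv.act g), braidHom_tmul hv, tensor_act_tmul (hw.act e) hv,
      hw.act_act, hw.act_act, ← TensorProduct.smul_tmul', ← TensorProduct.smul_tmul', smul_smul,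
      smul_smul, ← Units.val_mul, ← Units.val_mul, φ.tw_comm, mul_comm e g]

theorem isMor_lid : IsMor ((unit φ).tensor Y) Y (TensorProduct.lid k V).toLinearMap := by
  refine isMor_tensor (fun e f c v hc hv => ?_) (fun g e f c v hc hv => ?_)
  · by_cases he : e = 1
    · subst he
      simpa using hv.smul c
    · have : c = 0 := by simpa [IsHom, unit, he, eq_comm] using hc
      simp [this, IsHom]
  · by_cases he : e = 1
    · subst he
      simp [ThreeCocycle.tw_one_mid, unit]
    · have : c = 0 := by simpa [IsHom, unit, he, eq_comm] using hc
      simp [this]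

theorem isMor_rid : IsMor (Y.tensor (unit φ)) Y (TensorProduct.rid k V).toLinearMap := by
  refine isMor_tensor (fun f e v c hv hc => ?_) (fun g f e v c hv hc => ?_)
  · by_cases he : e = 1
    · subst he
      simpa using hv.smul c
    · have : c = 0 := by simpa [IsHom, unit, he, eq_comm] using hc
      simp [this, IsHom]
  · by_cases he : e = 1
    · subst he
      simp [ThreeCocycle.tw_one_right, unit]
    · have : c = 0 := by simpa [IsHom, unit, he, eq_comm] using hc
      simp [this]

theorem assocHom_naturality {V' W' U' : Type*} [AddCommGroup V'] [Module k V'] [AddCommGroup W']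
    [Module k W'] [AddCommGroup U'] [Module k U'] {Y' : YDModule φ V'} {Z' : YDModule φ W'}
    {T' : YDModule φ U'} {l : V →ₗ[k] V'} {m : W →ₗ[k] W'} {n : U →ₗ[k] U'}
    (hl : IsMor Y Y' l) (hm : IsMor Z Z' m) (hn : IsMor T T' n) :
    assocHom Y' Z' T' ∘ₗ TensorProduct.map (TensorProduct.map l m) n =
      TensorProduct.map l (TensorProduct.map m n) ∘ₗ assocHom Y Z T := by
  refine Y.ext_tmul₃ Z T fun x y z a b c ha hb hc => ?_
  simp only [LinearMap.comp_apply, TensorProduct.map_tmul, assocHom_tmul ha hb hc,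
    assocHom_tmul (hl.isHom ha) (hm.isHom hb) (hn.isHom hc), map_smul]

theorem pentagon {X : Type*} [AddCommGroup X] [Module k X] (Q : YDModule φ X) :
    (TensorProduct.map LinearMap.id (assocHom Z T Q) ∘ₗ assocHom Y (Z.tensor T) Q) ∘ₗ
      TensorProduct.map (assocHom Y Z T) LinearMap.id =
    assocHom Y Z (T.tensor Q) ∘ₗ assocHom (Y.tensor Z) T Q := by
  refine TensorProduct.ext (Y.ext_tmul₃ Z T fun x y z a b c ha hb hc =>
    Q.ext_isHom fun t d hd => ?_)
  simp only [LinearMap.compr₂ₛₗ_apply, TensorProduct.mk_apply, LinearMap.comp_apply,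
    TensorProduct.map_tmul, LinearMap.id_apply, assocHom_tmul ha hb hc, map_smul,
    ← TensorProduct.smul_tmul', TensorProduct.tmul_smul, assocHom_tmul ha (hb.tmul hc) hd,
    assocHom_tmul (ha.tmul hb) hc hd, assocHom_tmul ha hb (hc.tmul hd),
    assocHom_tmul hb hc hd, smul_smul, ← Units.val_mul]
  rw [← mul_inv, ← mul_inv, ← mul_inv, φ.cocycle, mul_assoc]

theorem triangle :
    TensorProduct.map LinearMap.id (TensorProduct.lid k W).toLinearMap ∘ₗ
      assocHom Y (unit φ) Z =
    TensorProduct.map (TensorProduct.rid k V).toLinearMap LinearMap.id := by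
  refine Y.ext_tmul₃ (unit φ) Z fun x _ y a c b ha _ hb => ?_
  simp [assocHom_tmul ha (unit_isHom c) hb, φ.normalized, TensorProduct.smul_tmul]

theorem hexagon_forward :
    (assocHom Z T Y ∘ₗ braidHom Y (Z.tensor T)) ∘ₗ assocHom Y Z T =
    (TensorProduct.map LinearMap.id (braidHom Y T) ∘ₗ assocHom Z Y T) ∘ₗ
      TensorProduct.map (braidHom Y Z) LinearMap.id := by
  refine Y.ext_tmul₃ Z T fun x y z a b c ha hb hc => ?_
  simp only [LinearMap.comp_apply, TensorProduct.map_tmul, LinearMap.id_apply,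
    assocHom_tmul ha hb hc, map_smul, braidHom_tmul ha, tensor_act_tmul hb hc,
    ← TensorProduct.smul_tmul', assocHom_tmul (hb.act x) (hc.act x) ha,
    assocHom_tmul (hb.act x) ha hc, smul_smul, ← Units.val_mul]
  congr 2
  simp only [ThreeCocycle.tw, div_eq_mul_inv]
  apply Additive.ofMul.injective
  simp only [ofMul_mul, ofMul_inv]
  abel

theorem hexagon_reverse :
    (assocInv T Y Z ∘ₗ braidHom (Y.tensor Z) T) ∘ₗ assocInv Y Z T =
    (TensorProduct.map (braidHom Y T) LinearMap.id ∘ₗ assocInv Y T Z) ∘ₗ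
      TensorProduct.map LinearMap.id (braidHom Z T) := by
  refine Y.ext_tmul₃' Z T fun x y z a b c ha hb hc => ?_
  simp only [LinearMap.comp_apply, TensorProduct.map_tmul, LinearMap.id_apply,
    assocInv_tmul ha hb hc, map_smul, braidHom_tmul ha, braidHom_tmul hb,
    braidHom_tmul (ha.tmul hb), assocInv_tmul (hc.act (x * y)) ha hb, hc.act_act,
    assocInv_tmul ha (hc.act y) hb,
    ← TensorProduct.smul_tmul', smul_smul, ← Units.val_mul]
  congr 2
  simp only [ThreeCocycle.tw, div_eq_mul_inv]
  apply Additive.ofMul.injective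
  simp only [ofMul_mul, ofMul_inv]
  abel

theorem braidHom_naturality_right {W' : Type*} [AddCommGroup W'] [Module k W']
    {Z' : YDModule φ W'} {m : W →ₗ[k] W'} (hm : IsMor Z Z' m) :
    braidHom Y Z' ∘ₗ TensorProduct.map LinearMap.id m =
      TensorProduct.map m LinearMap.id ∘ₗ braidHom Y Z := by
  refine Y.ext_tmul Z fun x y a b ha hb => ?_
  simp [braidHom_tmul ha, hm.map_act]

theorem braidHom_naturality_left {V' : Type*} [AddCommGroup V'] [Module k V']
    {Y' : YDModule φ V'} {l : V →ₗ[k] V'} (hl : IsMor Y Y' l) :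
    braidHom Y' Z ∘ₗ TensorProduct.map l LinearMap.id =
      TensorProduct.map LinearMap.id l ∘ₗ braidHom Y Z := by
  refine Y.ext_tmul Z fun x y a b ha hb => ?_
  simp [braidHom_tmul ha, braidHom_tmul (hl.isHom ha)]

end
end YDModule

universe u w

/-- An object of the Yetter-Drinfeld category of `(kG, Φ)`. -/
structure YD {G : Type w} {k : Type u} [CommGroup G] [Fintype G] [DecidableEq G] [Field k]
    (φ : ThreeCocycle G k) where
  V : Type u
  [addCommGroup : AddCommGroup V]
  [module : Module k V]
  str : YDModule φ V

namespace YD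

attribute [instance] YD.addCommGroup YD.module

section
variable {G : Type w} {k : Type u} [CommGroup G] [Fintype G] [DecidableEq G] [Field k]
  {φ : ThreeCocycle G k}

/-- Morphisms of Yetter-Drinfeld modules: graded linear maps commuting with the action. -/
@[ext]
structure Hom (A B : YD φ) where
  lin : A.V →ₗ[k] B.V
  isMor : YDModule.IsMor A.str B.str lin

instance : Category (YD φ) where
  Hom := Hom
  id A := ⟨LinearMap.id, fun _ _ => rfl, fun _ _ => rfl⟩
  comp f g := ⟨g.lin ∘ₗ f.lin, fun _ _ => by simp [f.isMor.map_proj, g.isMor.map_proj],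
    fun _ _ => by simp [f.isMor.map_act, g.isMor.map_act]⟩

theorem hom_ext {A B : YD φ} {f g : A ⟶ B} (h : f.lin = g.lin) : f = g := Hom.ext h

/-- An isomorphism from a morphism and its linear inverse. -/
def isoMk {A B : YD φ} (l : A.V →ₗ[k] B.V) (l' : B.V →ₗ[k] A.V)
    (h : YDModule.IsMor A.str B.str l) (h1 : l' ∘ₗ l = LinearMap.id)
    (h2 : l ∘ₗ l' = LinearMap.id) : A ≅ B where
  hom := ⟨l, h⟩
  inv := ⟨l', h.symm h1 h2⟩
  hom_inv_id := hom_ext h1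
  inv_hom_id := hom_ext h2

/-- The tensor product of morphisms. -/
def tensorMor {A B C D : YD φ} (f : A ⟶ B) (g : C ⟶ D) :
    Hom (⟨A.V ⊗[k] C.V, A.str.tensor C.str⟩ : YD φ) ⟨B.V ⊗[k] D.V, B.str.tensor D.str⟩ :=
  ⟨TensorProduct.map f.lin g.lin, f.isMor.tensor g.isMor⟩

instance : MonoidalCategoryStruct (YD φ) where
  tensorObj A B := ⟨A.V ⊗[k] B.V, A.str.tensor B.str⟩
  whiskerLeft A _ _ f := tensorMor (𝟙 A) f
  whiskerRight f A := tensorMor f (𝟙 A)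
  tensorHom f g := tensorMor f g
  tensorUnit := ⟨k, YDModule.unit φ⟩
  associator A B C := isoMk (YDModule.assocHom A.str B.str C.str)
    (YDModule.assocInv A.str B.str C.str) YDModule.isMor_assocHom
    YDModule.assocInv_comp_assocHom YDModule.assocHom_comp_assocInv
  leftUnitor A := isoMk (TensorProduct.lid k A.V).toLinearMap
    (TensorProduct.lid k A.V).symm.toLinearMap YDModule.isMor_lid
    (LinearEquiv.symm_comp _) (LinearEquiv.comp_symm _)
  rightUnitor A := isoMk (TensorProduct.rid k A.V).toLinearMap
    (TensorProduct.rid k A.V).symm.toLinearMap YDModule.isMor_rid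
    (LinearEquiv.symm_comp _) (LinearEquiv.comp_symm _)

instance : MonoidalCategory (YD φ) where
  tensorHom_def f g := hom_ext (TensorProduct.ext' fun _ _ => rfl)
  id_tensorHom_id A B := hom_ext (TensorProduct.ext' fun _ _ => rfl)
  tensorHom_comp_tensorHom f g f' g' := hom_ext (TensorProduct.ext' fun _ _ => rfl)
  whiskerLeft_id A B := hom_ext (TensorProduct.ext' fun _ _ => rfl)
  id_whiskerRight A B := hom_ext (TensorProduct.ext' fun _ _ => rfl)
  associator_naturality f g h :=
    hom_ext (YDModule.assocHom_naturality f.isMor g.isMor h.isMor)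
  leftUnitor_naturality f := hom_ext (TensorProduct.ext' fun c a => (f.lin.map_smul c a).symm)
  rightUnitor_naturality f := hom_ext (TensorProduct.ext' fun a c => (f.lin.map_smul c a).symm)
  pentagon A B C D := hom_ext (YDModule.pentagon D.str)
  triangle A B := hom_ext YDModule.triangle

instance : BraidedCategory (YD φ) where
  braiding A B := isoMk (YDModule.braidHom A.str B.str) (YDModule.braidInv A.str B.str)
    YDModule.isMor_braidHom YDModule.braidInv_comp_braidHom YDModule.braidHom_comp_braidInv
  braiding_naturality_right A _ _ f := hom_ext (YDModule.braidHom_naturality_right f.isMor)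
  braiding_naturality_left f B := hom_ext (YDModule.braidHom_naturality_left f.isMor)
  hexagon_forward A B C := hom_ext YDModule.hexagon_forward
  hexagon_reverse A B C := hom_ext YDModule.hexagon_reverse

end
end YD

section Majid
open Coalgebra

section
variable {k C N : Type*} [Field k] [AddCommGroup C] [Module k C] [Coalgebra k C]
  [AddCommGroup N] [Module k N]

/-- The convolution `c ↦ f(c₁) T(c₂)` of a functional `f` and a linear map `T` on a coalgebra. -/
noncomputable def convL (f : C →ₗ[k] k) (T : C →ₗ[k] N) : C →ₗ[k] N :=
  (TensorProduct.lid k N).toLinearMap ∘ₗ TensorProduct.map f T ∘ₗ comul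

/-- The convolution `c ↦ T(c₁) f(c₂)` of a linear map `T` and a functional `f` on a coalgebra. -/
noncomputable def convR (T : C →ₗ[k] N) (f : C →ₗ[k] k) : C →ₗ[k] N :=
  (TensorProduct.rid k N).toLinearMap ∘ₗ TensorProduct.map T f ∘ₗ comul

/-- The map `c ↦ c₁ ⊗ f(c₂) c₃` for a functional `f` on a coalgebra. -/
noncomputable def insertMid (f : C →ₗ[k] k) : C →ₗ[k] C ⊗[k] C :=
  (convL f LinearMap.id).lTensor C ∘ₗ comul

theorem convL_groupLike (f : C →ₗ[k] k) (T : C →ₗ[k] N) {c : C} (hc : IsGroupLikeElem k c) :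
    convL f T c = f c • T c := by
  simp [convL, hc.comul_eq_tmul_self]

theorem convR_groupLike (T : C →ₗ[k] N) (f : C →ₗ[k] k) {c : C} (hc : IsGroupLikeElem k c) :
    convR T f c = f c • T c := by
  simp [convR, hc.comul_eq_tmul_self]

theorem IsGroupLikeElem.tmul' {D : Type*} [AddCommGroup D] [Module k D] [Coalgebra k D]
    {c : C} {d : D} (hc : IsGroupLikeElem k c) (hd : IsGroupLikeElem k d) :
    IsGroupLikeElem k (c ⊗ₜ[k] d) where
  counit_eq_one := by simp [hc.counit_eq_one, hd.counit_eq_one]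
  comul_eq_tmul_self := by
    simp [TensorProduct.comul_tmul, hc.comul_eq_tmul_self, hd.comul_eq_tmul_self]

/-- The image of `P ⊗ Q` in `C ⊗ C`. -/
def tensorSub (P Q : Submodule k C) : Submodule k (C ⊗[k] C) :=
  LinearMap.range (TensorProduct.map P.subtype Q.subtype)

variable (k C) in
/-- `D` is a subcoalgebra: `Δ(D) ⊆ D ⊗ D`. -/
def IsSubcoalgebra (D : Submodule k C) : Prop :=
  ∀ d ∈ D, (comul d : C ⊗[k] C) ∈ tensorSub D D

/-- `D` is a simple subcoalgebra: it is nonzero, and `0` and `D` are its only subcoalgebras. -/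
def IsSimpleSubcoalgebra (D : Submodule k C) : Prop :=
  IsSubcoalgebra k C D ∧ D ≠ ⊥ ∧ ∀ E, IsSubcoalgebra k C E → E ≤ D → E = ⊥ ∨ E = D

variable (k C) in
/-- The coradical: the sum of all simple subcoalgebras. -/
def coradical : Submodule k C := sSup {D | IsSimpleSubcoalgebra D}

variable (k C) in
/-- The coradical filtration: `C₀` is the coradical and
`C_{n+1} = Δ⁻¹(C ⊗ C_n + C₀ ⊗ C)`. -/
def coradicalFiltration : ℕ → Submodule k C
  | 0 => coradical k C
  | n + 1 => (tensorSub ⊤ (coradicalFiltration n) ⊔ tensorSub (coradical k C) ⊤).comap comul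

variable (k C) in
/-- A coalgebra is pointed if its simple subcoalgebras (equivalently, its simple comodules) are
one-dimensional. -/
def IsPointed : Prop := ∀ D : Submodule k C, IsSimpleSubcoalgebra D → Module.finrank k D = 1

variable (k) in
/-- `X` is skew-primitive: `Δ(X) = X ⊗ g + h ⊗ X` with `g`, `h` group-like. -/
def IsSkewPrimitive (X : C) : Prop :=
  ∃ g h : C, IsGroupLikeElem k g ∧ IsGroupLikeElem k h ∧ comul X = X ⊗ₜ[k] g + h ⊗ₜ[k] X

end

/-- A Majid algebra (coquasi-Hopf algebra) structure on a coalgebra `M` with a bilinear, unital,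
not necessarily associative multiplication: the multiplication and the unit are coalgebra maps, the
multiplication is associative up to the convolution-invertible associator `Φ`, and `(S, α, β)` is
an antipode. -/
structure MajidAlgebra (k M : Type*) [Field k] [NonAssocRing M] [Module k M]
    [IsScalarTower k M M] [SMulCommClass k M M] [Coalgebra k M] where
  comul_mul : comul ∘ₗ LinearMap.mul' k M =
    TensorProduct.map (LinearMap.mul' k M) (LinearMap.mul' k M) ∘ₗ comul
  counit_mul : counit ∘ₗ LinearMap.mul' k M = (counit : M ⊗[k] M →ₗ[k] k)
  one_groupLike : IsGroupLikeElem k (1 : M)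
  /-- The associator. -/
  Φ : M ⊗[k] (M ⊗[k] M) →ₗ[k] k
  /-- The convolution inverse of the associator. -/
  Φinv : M ⊗[k] (M ⊗[k] M) →ₗ[k] k
  Φ_Φinv : convL Φ Φinv = counit
  Φinv_Φ : convL Φinv Φ = counit
  /-- `a₁(b₁c₁) Φ(a₂, b₂, c₂) = Φ(a₁, b₁, c₁) (a₂b₂)c₂`. -/
  quasi_assoc :
    convR (LinearMap.mul' k M ∘ₗ (LinearMap.mul' k M).lTensor M) Φ =
      convL Φ (LinearMap.mul' k M ∘ₗ (LinearMap.mul' k M).rTensor M ∘ₗ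
        (TensorProduct.assoc k M M M).symm.toLinearMap)
  /-- `Φ(a₁, b₁, c₁d₁) Φ(a₂b₂, c₂, d₂) = Φ(b₁, c₁, d₁) Φ(a₁, b₂c₂, d₂) Φ(a₂, b₃, c₃)`. -/
  Φ_cocycle :
    convL (Φ ∘ₗ ((LinearMap.mul' k M).lTensor M).lTensor M)
      (Φ ∘ₗ (LinearMap.mul' k M).rTensor (M ⊗[k] M) ∘ₗ
        (TensorProduct.assoc k M M (M ⊗[k] M)).symm.toLinearMap) =
    convL ((TensorProduct.lid k k).toLinearMap ∘ₗ TensorProduct.map counit Φ)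
      (convL (Φ ∘ₗ ((LinearMap.mul' k M).rTensor M ∘ₗ
          (TensorProduct.assoc k M M M).symm.toLinearMap).lTensor M)
        (Φ ∘ₗ (((TensorProduct.rid k M).toLinearMap ∘ₗ
          (counit : M →ₗ[k] k).lTensor M).lTensor M).lTensor M))
  Φ_one : ∀ a b : M, Φ (a ⊗ₜ (1 ⊗ₜ b)) = counit a * counit b
  /-- The antipode map. -/
  S : M →ₗ[k] M
  α : M →ₗ[k] k
  β : M →ₗ[k] k
  /-- `Δ(S(a)) = S(a₂) ⊗ S(a₁)`. -/
  comul_S : comul ∘ₗ S =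
    TensorProduct.map S S ∘ₗ (TensorProduct.comm k M M).toLinearMap ∘ₗ comul
  counit_S : counit ∘ₗ S = (counit : M →ₗ[k] k)
  /-- `S(a₁) α(a₂) a₃ = α(a) 1`. -/
  S_α : ∀ a, LinearMap.mul' k M (S.rTensor M (insertMid α a)) = α a • (1 : M)
  /-- `a₁ β(a₂) S(a₃) = β(a) 1`. -/
  β_S : ∀ a, LinearMap.mul' k M (S.lTensor M (insertMid β a)) = β a • (1 : M)
  /-- `Φ(a₁, S(a₃), a₅) β(a₂) α(a₄) = ε(a)`. -/
  Φ_S : ∀ a, Φ ((S.rTensor M).lTensor M ((insertMid α).lTensor M (insertMid β a))) =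
    counit a
  /-- `Φ⁻¹(S(a₁), a₃, S(a₅)) α(a₂) β(a₄) = ε(a)`. -/
  Φinv_S : ∀ a, Φinv (TensorProduct.map S (S.lTensor M)
    ((insertMid β).lTensor M (insertMid α a))) = counit a

/-- A graded pointed Majid algebra `M = ⨁ M(n)` generated by an abelian group `G` (its group of
group-like elements) and skew-primitive elements.  It is coradically graded, and its multiplication,
associator and antipode respect the grading.  The antipode is normalized by `α(g) = 1` for `g ∈ G`;
then `S(g) = g⁻¹` and `β(g) = Φ(g, g⁻¹, g)⁻¹`. -/
structure GradedPointedMajidAlgebra (k M G : Type*) [Field k] [NonAssocRing M] [Module k M]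
    [IsScalarTower k M M] [SMulCommClass k M M] [Coalgebra k M] [CommGroup G] extends
    MajidAlgebra k M where
  /-- The inclusion of the group of group-like elements. -/
  of : G → M
  of_injective : Function.Injective of
  of_one : of 1 = 1
  of_mul : ∀ g h, of (g * h) = of g * of h
  range_of : Set.range of = {x | IsGroupLikeElem k x}
  pointed : IsPointed k M
  /-- The graded pieces `M(n)`. -/
  gr : ℕ → Submodule k M
  /-- `M = ⨁ M(n)`. -/
  decomp : DirectSum.Decomposition gr
  /-- The coradical filtration is `M_n = ⨁_{i ≤ n} M(i)`. -/
  coradically_graded : ∀ n, coradicalFiltration k M n = ⨆ i ≤ n, gr i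
  gr_comul : ∀ n, ∀ x ∈ gr n,
    (comul x : M ⊗[k] M) ∈ ⨆ p : ℕ × ℕ, ⨆ _ : p.1 + p.2 = n, tensorSub (gr p.1) (gr p.2)
  gr_counit : ∀ n ≠ 0, ∀ x ∈ gr n, counit (R := k) x = 0
  gr_mul : ∀ i j, ∀ x ∈ gr i, ∀ y ∈ gr j, x * y ∈ gr (i + j)
  gr_one : (1 : M) ∈ gr 0
  gr_Φ : ∀ i j l, i + j + l ≠ 0 → ∀ x ∈ gr i, ∀ y ∈ gr j, ∀ z ∈ gr l, Φ (x ⊗ₜ (y ⊗ₜ z)) = 0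
  gr_S : ∀ n, ∀ x ∈ gr n, S x ∈ gr n
  gr_α : ∀ n ≠ 0, ∀ x ∈ gr n, α x = 0
  gr_β : ∀ n ≠ 0, ∀ x ∈ gr n, β x = 0
  α_of : ∀ g, α (of g) = 1
  generated : NonUnitalAlgebra.adjoin k (Set.range of ∪ {X | IsSkewPrimitive k X}) = ⊤

namespace GradedPointedMajidAlgebra

attribute [instance] decomp

section
variable {k M G : Type*} [Field k] [NonAssocRing M] [Module k M]
    [IsScalarTower k M M] [SMulCommClass k M M] [Coalgebra k M] [CommGroup G]
    (H : GradedPointedMajidAlgebra k M G)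

theorem of_groupLike (g : G) : IsGroupLikeElem k (H.of g) := by
  have : H.of g ∈ Set.range H.of := ⟨g, rfl⟩
  rwa [H.range_of] at this

theorem Φ_mul_Φinv (a b c : G) : H.Φ (H.of a ⊗ₜ (H.of b ⊗ₜ H.of c)) *
    H.Φinv (H.of a ⊗ₜ (H.of b ⊗ₜ H.of c)) = 1 := by
  have hg := (H.of_groupLike a).tmul' ((H.of_groupLike b).tmul' (H.of_groupLike c))
  have := LinearMap.congr_fun H.Φ_Φinv (H.of a ⊗ₜ (H.of b ⊗ₜ H.of c))
  rwa [convL_groupLike _ _ hg, hg.counit_eq_one] at this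

/-- The normalized 3-cocycle on `G` which is the restriction of the associator of `M`. -/
def cocycle : ThreeCocycle G k where
  toFun a b c := ⟨H.Φ (H.of a ⊗ₜ (H.of b ⊗ₜ H.of c)), H.Φinv (H.of a ⊗ₜ (H.of b ⊗ₜ H.of c)),
    H.Φ_mul_Φinv a b c, by rw [mul_comm, H.Φ_mul_Φinv]⟩
  cocycle a b c d := by
    have hg := (H.of_groupLike a).tmul' ((H.of_groupLike b).tmul'
      ((H.of_groupLike c).tmul' (H.of_groupLike d)))
    have := LinearMap.congr_fun H.Φ_cocycle (H.of a ⊗ₜ (H.of b ⊗ₜ (H.of c ⊗ₜ H.of d)))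
    rw [convL_groupLike _ _ hg, convL_groupLike _ _ hg, convL_groupLike _ _ hg] at this
    simp only [LinearMap.comp_apply, LinearMap.lTensor_tmul, LinearMap.rTensor_tmul,
      TensorProduct.map_tmul, LinearEquiv.coe_coe, TensorProduct.assoc_symm_tmul,
      LinearMap.mul'_apply, TensorProduct.lid_tmul, TensorProduct.rid_tmul,
      (H.of_groupLike _).counit_eq_one, one_smul, smul_eq_mul, ← H.of_mul] at this
    apply Units.ext
    simp only [Units.val_mul]
    linear_combination this
  normalized a c := by
    apply Units.ext
    simp [H.of_one, H.Φ_one, (H.of_groupLike _).counit_eq_one]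

/-- The canonical projection `π : M → M(0) = kG`, as an endomorphism of `M`. -/
noncomputable def π : M →ₗ[k] M :=
  (H.gr 0).subtype ∘ₗ DirectSum.component k ℕ (fun n => H.gr n) 0 ∘ₗ
    (DirectSum.decomposeLinearEquiv H.gr).toLinearMap

/-- The coinvariant subalgebra `R = {x | (id ⊗ π)Δ(x) = x ⊗ 1}`. -/
noncomputable def coinv : Submodule k M :=
  LinearMap.eqLocus (H.π.lTensor M ∘ₗ comul) ((TensorProduct.mk k M M).flip 1)

/-- `ᵍMʰ = {m | (π ⊗ id)Δ(m) = g ⊗ m, (id ⊗ π)Δ(m) = m ⊗ h}`. -/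
noncomputable def biComp (g h : G) : Submodule k M :=
  LinearMap.eqLocus (H.π.rTensor M ∘ₗ comul) (TensorProduct.mk k M M (H.of g)) ⊓
    LinearMap.eqLocus (H.π.lTensor M ∘ₗ comul) ((TensorProduct.mk k M M).flip (H.of h))

/-- `Δ(X) = ∑ i, X₁ i ⊗ X₂ i` is a presentation of `Δ(X)`, for `X ∈ R`, in which `X₂ i ∈ R` is
homogeneous of degree `x₂ i` and `X₁ i · (x₂ i)⁻¹ ∈ R` is homogeneous of degree `x₁ i`, that is
`X₁ i` lies in the bigraded component of degrees `x₁ i x₂ i` (left) and `x₂ i` (right). -/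
structure IsHomRep (X : M) {n : ℕ} (X₁ X₂ : Fin n → M) (x₁ x₂ : Fin n → G) : Prop where
  comul_eq : comul X = ∑ i, X₁ i ⊗ₜ[k] X₂ i
  left : ∀ i, X₁ i ∈ H.biComp (x₁ i * x₂ i) (x₂ i)
  right : ∀ i, X₂ i ∈ H.biComp (x₂ i) 1

end
end GradedPointedMajidAlgebra
end Majid

/-! Write `δ_g` for the functional on `M` that takes the coefficient of `g` in `π(m)`. As the
comultiplication is graded, the `δ_g` are orthogonal idempotents of the convolution algebra `M*`
with sum `ε`. Convolving with them on either side splits `M` into components of left degree `g` and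
right degree `h`. The associator and `β` vanish in positive degree, so they are combinations of the
`δ_g`. Hence bihomogeneous elements associate up to the scalar `Φ(right degrees) / Φ(left degrees)`
(`IsBi.assoc_eq`).

`R` is the part of right degree `1`, and an element of right degree `h` is `X · h` for exactly one
`X ∈ R`, which `strip` recovers. The action is characterised by `(f ▷ X) · f = f · X`. Identities in
`R` can be tested after right multiplication by a group element, where they reduce to identities
between values of the cocycle.

The comultiplication of `R` is `(strip ⊗ strip) Δ`. The injection `unstrip : X ⊗ Y ↦ X · y ⊗ Y`
turns it back into `Δ` (`unstrip_coinvComul`). It also turns the diagonal action into conjugation by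
`f ⊗ f` (`unstrip_act`) and the braided product of `R ⊗ R` into the componentwise product of `M ⊗ M`
(`unstrip_coinvMul_tensorμ`). Its threefold version turns the associativity constraint into plain
reassociation. Equivariance, coassociativity and multiplicativity of the comultiplication of `R` are
therefore inherited from `Δ`.

The antipode axiom for `β` says on `R` that `S_R` is a right convolution inverse of the identity.
Convolution is associative on graded endomorphisms of `R`, so left convolution with the identity is
surjective there, hence injective by finite dimension. This cancellation makes `S_R` a left inverse
too. It also makes `S_R` equivariant, since its conjugate by `f ▷ _` is another graded right
inverse. -/

section TmulForm

variable {k C D : Type*} [Field k] [AddCommGroup C] [Module k C] [AddCommGroup D] [Module k D]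

/-- The functional `c ⊗ d ↦ f(c) g(d)`. -/
noncomputable def tmulForm (f : C →ₗ[k] k) (g : D →ₗ[k] k) : C ⊗[k] D →ₗ[k] k :=
  LinearMap.mul' k k ∘ₗ TensorProduct.map f g

@[simp]
theorem tmulForm_tmul (f : C →ₗ[k] k) (g : D →ₗ[k] k) (c : C) (d : D) :
    tmulForm f g (c ⊗ₜ d) = f c * g d := by
  simp [tmulForm]

end TmulForm

/-! ### Convolution of functionals with linear maps on a coalgebra -/

section Convolution
open Coalgebra

variable {k C D N P : Type*} [Field k] [AddCommGroup C] [Module k C] [Coalgebra k C]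
  [AddCommGroup D] [Module k D] [Coalgebra k D] [AddCommGroup N] [Module k N]
  [AddCommGroup P] [Module k P]

theorem comp_convL (l : N →ₗ[k] P) (f : C →ₗ[k] k) (T : C →ₗ[k] N) :
    convL f (l ∘ₗ T) = l ∘ₗ convL f T := by
  ext c
  simp only [convL, LinearMap.comp_apply]
  induction (comul c : C ⊗[k] C) using TensorProduct.induction_on with
  | zero => simp
  | tmul x y => simp
  | add x y hx hy => simp only [map_add, hx, hy]

theorem comp_convR (l : N →ₗ[k] P) (f : C →ₗ[k] k) (T : C →ₗ[k] N) :
    convR (l ∘ₗ T) f = l ∘ₗ convR T f := by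
  ext c
  simp only [convR, LinearMap.comp_apply]
  induction (comul c : C ⊗[k] C) using TensorProduct.induction_on with
  | zero => simp
  | tmul x y => simp
  | add x y hx hy => simp only [map_add, hx, hy]

theorem convR_eq_convL (f g : C →ₗ[k] k) : convR f g = convL f g := by
  ext c
  simp only [convL, convR, LinearMap.comp_apply]
  induction (comul c : C ⊗[k] C) using TensorProduct.induction_on with
  | zero => simp
  | tmul x y => simp [mul_comm]
  | add x y hx hy => simp only [map_add, hx, hy]

theorem convL_counit (T : C →ₗ[k] N) : convL counit T = T := by
  ext c
  have h : convL counit T c = TensorProduct.lid k N (T.lTensor k (counit.rTensor C (comul c))) := by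
    simp only [convL, LinearMap.comp_apply]
    rw [← LinearMap.comp_apply (T.lTensor k), LinearMap.lTensor_comp_rTensor]
    rfl
  rw [h, rTensor_counit_comul]
  simp

theorem convR_counit (T : C →ₗ[k] N) : convR T counit = T := by
  ext c
  have h : convR T counit c = TensorProduct.rid k N (T.rTensor k (counit.lTensor C (comul c))) := by
    simp only [convR, LinearMap.comp_apply]
    rw [← LinearMap.comp_apply (T.rTensor k), LinearMap.rTensor_comp_lTensor]
    rfl
  rw [h, lTensor_counit_comul]
  simp

/-- Each side is one and the same linear map applied to one of the two bracketings of the iterated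
comultiplication, so coassociativity identifies them. The next two lemmas and the three
comultiplication lemmas below follow the same pattern. -/
theorem convL_convL (f g : C →ₗ[k] k) (T : C →ₗ[k] N) :
    convL f (convL g T) = convL (convL f g) T := by
  ext c
  have h1 : ∀ t : C ⊗[k] C, TensorProduct.lid k N (TensorProduct.map f (convL g T) t) =
      TensorProduct.lid k N (TensorProduct.map f ((TensorProduct.lid k N).toLinearMap ∘ₗ
        TensorProduct.map g T) (comul.lTensor C t)) := by
    intro t
    induction t using TensorProduct.induction_on with
    | zero => simp
    | tmul x y => simp [convL]
    | add x y hx hy => simp only [map_add, hx, hy]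
  have h2 : ∀ t : C ⊗[k] C, TensorProduct.lid k N (TensorProduct.map (convL f g) T t) =
      TensorProduct.lid k N (TensorProduct.map f ((TensorProduct.lid k N).toLinearMap ∘ₗ
        TensorProduct.map g T) (TensorProduct.assoc k C C C (comul.rTensor C t))) := by
    intro t
    induction t using TensorProduct.induction_on with
    | zero => simp
    | tmul x y =>
      simp only [convL, LinearMap.comp_apply, TensorProduct.map_tmul, LinearMap.rTensor_tmul]
      induction (comul x : C ⊗[k] C) using TensorProduct.induction_on with
      | zero => simp
      | tmul a b => simp [mul_smul, smul_comm (g b) (f a)]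
      | add a b ha hb => simp only [map_add, TensorProduct.add_tmul, ha, hb]
    | add x y hx hy => simp only [map_add, hx, hy]
  have h3 := h1 (comul c)
  have h4 := h2 (comul c)
  rw [coassoc_apply] at h4
  simpa [convL] using h3.trans h4.symm

theorem convR_convR (T : C →ₗ[k] N) (f g : C →ₗ[k] k) :
    convR (convR T f) g = convR T (convL f g) := by
  ext c
  have h1 : ∀ t : C ⊗[k] C, TensorProduct.rid k N (TensorProduct.map T (convL f g) t) =
      TensorProduct.rid k N (TensorProduct.map T ((TensorProduct.lid k k).toLinearMap ∘ₗ
        TensorProduct.map f g) (comul.lTensor C t)) := by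
    intro t
    induction t using TensorProduct.induction_on with
    | zero => simp
    | tmul x y => simp [convL]
    | add x y hx hy => simp only [map_add, hx, hy]
  have h2 : ∀ t : C ⊗[k] C, TensorProduct.rid k N (TensorProduct.map (convR T f) g t) =
      TensorProduct.rid k N (TensorProduct.map T ((TensorProduct.lid k k).toLinearMap ∘ₗ
        TensorProduct.map f g) (TensorProduct.assoc k C C C (comul.rTensor C t))) := by
    intro t
    induction t using TensorProduct.induction_on with
    | zero => simp
    | tmul x y =>
      simp only [convR, LinearMap.comp_apply, TensorProduct.map_tmul, LinearMap.rTensor_tmul]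
      induction (comul x : C ⊗[k] C) using TensorProduct.induction_on with
      | zero => simp
      | tmul a b => simp [mul_smul, smul_comm (f b) (g y)]
      | add a b ha hb => simp only [map_add, TensorProduct.add_tmul, ha, hb]
    | add x y hx hy => simp only [map_add, hx, hy]
  have h3 := h1 (comul c)
  have h4 := h2 (comul c)
  rw [coassoc_apply] at h4
  simpa [convR] using h4.trans h3.symm

theorem convL_convR (f : C →ₗ[k] k) (T : C →ₗ[k] N) (g : C →ₗ[k] k) :
    convL f (convR T g) = convR (convL f T) g := by
  ext c
  have h1 : ∀ t : C ⊗[k] C, TensorProduct.lid k N (TensorProduct.map f (convR T g) t) =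
      TensorProduct.lid k N (TensorProduct.map f ((TensorProduct.rid k N).toLinearMap ∘ₗ
        TensorProduct.map T g) (comul.lTensor C t)) := by
    intro t
    induction t using TensorProduct.induction_on with
    | zero => simp
    | tmul x y => simp [convR]
    | add x y hx hy => simp only [map_add, hx, hy]
  have h2 : ∀ t : C ⊗[k] C, TensorProduct.rid k N (TensorProduct.map (convL f T) g t) =
      TensorProduct.lid k N (TensorProduct.map f ((TensorProduct.rid k N).toLinearMap ∘ₗ
        TensorProduct.map T g) (TensorProduct.assoc k C C C (comul.rTensor C t))) := by
    intro t
    induction t using TensorProduct.induction_on with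
    | zero => simp
    | tmul x y =>
      simp only [convL, LinearMap.comp_apply, TensorProduct.map_tmul, LinearMap.rTensor_tmul]
      induction (comul x : C ⊗[k] C) using TensorProduct.induction_on with
      | zero => simp
      | tmul a b => simp
      | add a b ha hb => simp only [map_add, TensorProduct.add_tmul, ha, hb]
    | add x y hx hy => simp only [map_add, hx, hy]
  have h3 := h1 (comul c)
  have h4 := h2 (comul c)
  rw [coassoc_apply] at h4
  simpa [convL, convR] using h3.trans h4.symm

/-- A product functional on the tensor coalgebra acts factor by factor. This is what allows
convolution with `Φ`, once expanded in product functionals, to be evaluated on pure tensors. -/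
theorem convL_tmulForm (f : C →ₗ[k] k) (g : D →ₗ[k] k) (T : C ⊗[k] D →ₗ[k] N) :
    convL (tmulForm f g) T =
      T ∘ₗ TensorProduct.map (convL f LinearMap.id) (convL g LinearMap.id) := by
  ext c d
  simp only [TensorProduct.AlgebraTensorModule.curry_apply, LinearMap.restrictScalars_self,
    TensorProduct.curry_apply, convL, LinearMap.comp_apply, TensorProduct.map_tmul,
    TensorProduct.comul_tmul]
  induction (comul c : C ⊗[k] C) using TensorProduct.induction_on with
  | zero => simp
  | tmul x y =>
    induction (comul d : D ⊗[k] D) using TensorProduct.induction_on with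
    | zero => simp
    | tmul a b => simp [← TensorProduct.smul_tmul', smul_smul, mul_comm]
    | add a b ha hb => simp only [map_add, TensorProduct.tmul_add, ha, hb]
  | add x y hx hy => simp only [map_add, TensorProduct.add_tmul, hx, hy]

theorem convR_tmulForm (f : C →ₗ[k] k) (g : D →ₗ[k] k) (T : C ⊗[k] D →ₗ[k] N) :
    convR T (tmulForm f g) =
      T ∘ₗ TensorProduct.map (convR LinearMap.id f) (convR LinearMap.id g) := by
  ext c d
  simp only [TensorProduct.AlgebraTensorModule.curry_apply, LinearMap.restrictScalars_self,
    TensorProduct.curry_apply, convR, LinearMap.comp_apply, TensorProduct.map_tmul,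
    TensorProduct.comul_tmul]
  induction (comul c : C ⊗[k] C) using TensorProduct.induction_on with
  | zero => simp
  | tmul x y =>
    induction (comul d : D ⊗[k] D) using TensorProduct.induction_on with
    | zero => simp
    | tmul a b => simp [← TensorProduct.smul_tmul', smul_smul, mul_comm]
    | add a b ha hb => simp only [map_add, TensorProduct.tmul_add, ha, hb]
  | add x y hx hy => simp only [map_add, TensorProduct.add_tmul, hx, hy]

theorem convL_add_left (f g : C →ₗ[k] k) (T : C →ₗ[k] N) :
    convL (f + g) T = convL f T + convL g T := by
  simp [convL, TensorProduct.map_add_left, LinearMap.add_comp, LinearMap.comp_add]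

theorem convL_smul_left (a : k) (f : C →ₗ[k] k) (T : C →ₗ[k] N) :
    convL (a • f) T = a • convL f T := by
  simp [convL, TensorProduct.map_smul_left, LinearMap.smul_comp, LinearMap.comp_smul]

theorem convR_add_right (f g : C →ₗ[k] k) (T : C →ₗ[k] N) :
    convR T (f + g) = convR T f + convR T g := by
  simp [convR, TensorProduct.map_add_right, LinearMap.add_comp, LinearMap.comp_add]

theorem convR_smul_right (a : k) (f : C →ₗ[k] k) (T : C →ₗ[k] N) :
    convR T (a • f) = a • convR T f := by
  simp [convR, TensorProduct.map_smul_right, LinearMap.smul_comp, LinearMap.comp_smul]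

theorem convL_sum_left {ι : Type*} (s : Finset ι) (f : ι → C →ₗ[k] k) (T : C →ₗ[k] N) :
    convL (∑ i ∈ s, f i) T = ∑ i ∈ s, convL (f i) T :=
  map_sum (IsLinearMap.mk' (fun f => convL f T)
    ⟨fun f g => convL_add_left f g T, fun a f => convL_smul_left a f T⟩) f s

theorem convR_sum_right {ι : Type*} (s : Finset ι) (f : ι → C →ₗ[k] k) (T : C →ₗ[k] N) :
    convR T (∑ i ∈ s, f i) = ∑ i ∈ s, convR T (f i) :=
  map_sum (IsLinearMap.mk' (fun f => convR T f)
    ⟨fun f g => convR_add_right f g T, fun a f => convR_smul_right a f T⟩) f s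

theorem convL_comp_coalgebra {l : C →ₗ[k] D} (hl : comul ∘ₗ l = TensorProduct.map l l ∘ₗ comul)
    (f : D →ₗ[k] k) (T : D →ₗ[k] N) : convL f T ∘ₗ l = convL (f ∘ₗ l) (T ∘ₗ l) := by
  simp only [convL, TensorProduct.map_comp, LinearMap.comp_assoc, hl]

theorem convR_comp_coalgebra {l : C →ₗ[k] D} (hl : comul ∘ₗ l = TensorProduct.map l l ∘ₗ comul)
    (f : D →ₗ[k] k) (T : D →ₗ[k] N) : convR T f ∘ₗ l = convR (T ∘ₗ l) (f ∘ₗ l) := by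
  simp only [convR, TensorProduct.map_comp, LinearMap.comp_assoc, hl]

/-- An anti-coalgebra map exchanges the two sides; it will be applied to the antipode. -/
theorem convL_comp_anti {l : C →ₗ[k] D} (hl : comul ∘ₗ l =
    TensorProduct.map l l ∘ₗ (TensorProduct.comm k C C).toLinearMap ∘ₗ comul)
    (f : D →ₗ[k] k) (T : D →ₗ[k] N) : convL f T ∘ₗ l = convR (T ∘ₗ l) (f ∘ₗ l) := by
  ext c
  have := LinearMap.congr_fun hl c
  simp only [LinearMap.comp_apply, LinearEquiv.coe_coe] at this
  simp only [convL, convR, LinearMap.comp_apply, this]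
  induction (comul c : C ⊗[k] C) using TensorProduct.induction_on with
  | zero => simp
  | tmul x y => simp
  | add x y hx hy => simp only [map_add, hx, hy]

theorem convR_comp_anti {l : C →ₗ[k] D} (hl : comul ∘ₗ l =
    TensorProduct.map l l ∘ₗ (TensorProduct.comm k C C).toLinearMap ∘ₗ comul)
    (f : D →ₗ[k] k) (T : D →ₗ[k] N) : convR T f ∘ₗ l = convL (f ∘ₗ l) (T ∘ₗ l) := by
  ext c
  have := LinearMap.congr_fun hl c
  simp only [LinearMap.comp_apply, LinearEquiv.coe_coe] at this
  simp only [convL, convR, LinearMap.comp_apply, this]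
  induction (comul c : C ⊗[k] C) using TensorProduct.induction_on with
  | zero => simp
  | tmul x y => simp
  | add x y hx hy => simp only [map_add, hx, hy]

/-- Both sides are `c₁ ⊗ f(c₂) c₃`. For `f = δ_e` this means that in `Δ(c)` the right degree of the
first leg matches the left degree of the second. -/
theorem lTensor_convL_comul (f : C →ₗ[k] k) :
    (convL f LinearMap.id).lTensor C ∘ₗ comul = (convR LinearMap.id f).rTensor C ∘ₗ comul := by
  ext c
  let F : C ⊗[k] (C ⊗[k] C) →ₗ[k] C ⊗[k] C :=
    ((TensorProduct.lid k C).toLinearMap ∘ₗ f.rTensor C).lTensor C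
  have h1 : ∀ t : C ⊗[k] C, (convL f LinearMap.id).lTensor C t = F (comul.lTensor C t) := by
    intro t
    induction t using TensorProduct.induction_on with
    | zero => simp
    | tmul x y => rfl
    | add x y hx hy => simp only [map_add, hx, hy]
  have h2 : ∀ t : C ⊗[k] C, (convR LinearMap.id f).rTensor C t =
      F (TensorProduct.assoc k C C C (comul.rTensor C t)) := by
    intro t
    induction t using TensorProduct.induction_on with
    | zero => simp
    | tmul x y =>
      simp only [convR, LinearMap.comp_apply, LinearMap.rTensor_tmul]
      induction (comul x : C ⊗[k] C) using TensorProduct.induction_on with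
      | zero => simp
      | tmul a b => simp [F, TensorProduct.smul_tmul]
      | add a b ha hb => simp only [map_add, TensorProduct.add_tmul, ha, hb]
    | add x y hx hy => simp only [map_add, hx, hy]
  rw [LinearMap.comp_apply, LinearMap.comp_apply, h1, h2, coassoc_apply]

theorem comul_comp_convL (f : C →ₗ[k] k) :
    comul ∘ₗ convL f LinearMap.id = (convL f LinearMap.id).rTensor C ∘ₗ comul := by
  ext c
  let F : C ⊗[k] (C ⊗[k] C) →ₗ[k] C ⊗[k] C :=
    (TensorProduct.lid k (C ⊗[k] C)).toLinearMap ∘ₗ f.rTensor (C ⊗[k] C)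
  have h1 : ∀ t : C ⊗[k] C, comul (TensorProduct.lid k C (TensorProduct.map f LinearMap.id t)) =
      F (comul.lTensor C t) := by
    intro t
    induction t using TensorProduct.induction_on with
    | zero => simp
    | tmul x y => simp [F]
    | add x y hx hy => simp only [map_add, hx, hy]
  have h2 : ∀ t : C ⊗[k] C, (convL f LinearMap.id).rTensor C t =
      F (TensorProduct.assoc k C C C (comul.rTensor C t)) := by
    intro t
    induction t using TensorProduct.induction_on with
    | zero => simp
    | tmul x y =>
      simp only [convL, LinearMap.comp_apply, LinearMap.rTensor_tmul]
      induction (comul x : C ⊗[k] C) using TensorProduct.induction_on with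
      | zero => simp
      | tmul a b => simp [F, TensorProduct.smul_tmul']
      | add a b ha hb => simp only [map_add, TensorProduct.add_tmul, ha, hb]
    | add x y hx hy => simp only [map_add, hx, hy]
  rw [LinearMap.comp_apply, LinearMap.comp_apply, h2, coassoc_apply, ← h1]
  rfl

theorem comul_comp_convR (f : C →ₗ[k] k) :
    comul ∘ₗ convR LinearMap.id f = (convR LinearMap.id f).lTensor C ∘ₗ comul := by
  ext c
  let F : C ⊗[k] (C ⊗[k] C) →ₗ[k] C ⊗[k] C :=
    ((TensorProduct.rid k C).toLinearMap ∘ₗ f.lTensor C).lTensor C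
  have h1 : ∀ t : C ⊗[k] C, (convR LinearMap.id f).lTensor C t = F (comul.lTensor C t) := by
    intro t
    induction t using TensorProduct.induction_on with
    | zero => simp
    | tmul x y => rfl
    | add x y hx hy => simp only [map_add, hx, hy]
  have h2 : ∀ t : C ⊗[k] C, comul (TensorProduct.rid k C (TensorProduct.map LinearMap.id f t)) =
      F (TensorProduct.assoc k C C C (comul.rTensor C t)) := by
    intro t
    induction t using TensorProduct.induction_on with
    | zero => simp
    | tmul x y =>
      simp only [TensorProduct.map_tmul, LinearMap.rTensor_tmul, TensorProduct.rid_tmul, map_smul,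
        LinearMap.id_apply]
      induction (comul x : C ⊗[k] C) using TensorProduct.induction_on with
      | zero => simp
      | tmul a b => simp [F]
      | add a b ha hb => simp only [map_add, TensorProduct.add_tmul, smul_add, ha, hb]
    | add x y hx hy => simp only [map_add, hx, hy]
  rw [LinearMap.comp_apply, LinearMap.comp_apply, h1, ← coassoc_apply, ← h2]
  rfl

end Convolution

/-! ### The coradical of a pointed coalgebra -/

section Majid
open Coalgebra

section
variable {k C : Type*} [Field k] [AddCommGroup C] [Module k C] [Coalgebra k C]

theorem IsGroupLikeElem.span_isSimpleSubcoalgebra {c : C} (hc : IsGroupLikeElem k c) :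
    IsSimpleSubcoalgebra (Submodule.span k {c}) := by
  have h0 : c ≠ 0 := hc.ne_zero
  refine ⟨fun d hd => ?_, by simpa using h0, fun E _ hE => ?_⟩
  · obtain ⟨a, rfl⟩ := Submodule.mem_span_singleton.1 hd
    have hc' : c ∈ Submodule.span k {c} := Submodule.mem_span_singleton_self c
    rw [map_smul, hc.comul_eq_tmul_self]
    exact Submodule.smul_mem _ _ ⟨⟨c, hc'⟩ ⊗ₜ ⟨c, hc'⟩, by simp⟩
  · exact ((nonzero_span_atom c h0).le_iff).1 hE

/-- On a line `Δ(d) = a d ⊗ d` for a scalar `a`, and the counit axiom forces `a ε(d) = 1`; the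
group-like generator is then `a d`. -/
theorem IsSimpleSubcoalgebra.exists_groupLike {D : Submodule k C} (hD : IsSimpleSubcoalgebra D)
    (h : Module.finrank k D = 1) : ∃ c, IsGroupLikeElem k c ∧ D = Submodule.span k {c} := by
  obtain ⟨⟨d, hd⟩, hd0, hd1⟩ := finrank_eq_one_iff'.1 h
  have hd0 : d ≠ 0 := fun h => hd0 (by simp [h])
  have hspan : D = Submodule.span k {d} := by
    ext x
    rw [Submodule.mem_span_singleton]
    constructor
    · intro hx
      obtain ⟨a, ha⟩ := hd1 ⟨x, hx⟩
      exact ⟨a, congrArg Subtype.val ha⟩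
    · rintro ⟨a, rfl⟩
      exact D.smul_mem a hd
  obtain ⟨a, ha⟩ : ∃ a : k, (comul d : C ⊗[k] C) = a • (d ⊗ₜ d) := by
    obtain ⟨t, ht⟩ := hD.1 d hd
    rw [← ht]
    clear ht
    induction t using TensorProduct.induction_on with
    | zero => exact ⟨0, by simp⟩
    | tmul x y =>
      obtain ⟨a, ha⟩ := hd1 x
      obtain ⟨b, hb⟩ := hd1 y
      rw [← ha, ← hb]
      exact ⟨a * b, by simp [← TensorProduct.smul_tmul', smul_smul, mul_comm]⟩
    | add x y hx hy =>
      obtain ⟨a, ha⟩ := hx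
      obtain ⟨b, hb⟩ := hy
      exact ⟨a + b, by rw [map_add, ha, hb, add_smul]⟩
  have h1 : (a * counit (R := k) d) • d = d := by
    have := rTensor_counit_comul (R := k) d
    rw [ha] at this
    have := congrArg (TensorProduct.lid k C) this
    simpa [smul_smul] using this
  have h2 : a * counit (R := k) d = 1 := by
    by_contra hne
    have : (a * counit (R := k) d - 1) • d = 0 := by rw [sub_smul, h1, one_smul, sub_self]
    rcases smul_eq_zero.1 this with h | h
    · exact hne (sub_eq_zero.1 h)
    · exact hd0 h
  have ha0 : a ≠ 0 := by
    rintro rfl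
    simp at h2
  refine ⟨a • d, ⟨by simpa using h2, ?_⟩, ?_⟩
  · rw [map_smul, ha]
    simp [← TensorProduct.smul_tmul', smul_smul]
  · rw [hspan]
    exact (Submodule.span_singleton_smul_eq (IsUnit.mk0 a ha0) d).symm

theorem IsPointed.coradical_eq (h : IsPointed k C) :
    coradical k C = Submodule.span k {c | IsGroupLikeElem k c} := by
  apply le_antisymm
  · refine sSup_le fun D hD => ?_
    obtain ⟨c, hc, rfl⟩ := hD.exists_groupLike (h D hD)
    exact Submodule.span_mono (by simpa using hc)
  · rw [Submodule.span_le]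
    intro c hc
    exact le_sSup (a := Submodule.span k {c}) hc.span_isSimpleSubcoalgebra
      (Submodule.mem_span_singleton_self c)

end

/-! ### The coefficient functionals of the projection onto the group algebra -/

namespace GradedPointedMajidAlgebra

section
variable {k M G : Type*} [Field k] [NonAssocRing M] [Module k M]
    [IsScalarTower k M M] [SMulCommClass k M M] [Coalgebra k M] [CommGroup G]
    (H : GradedPointedMajidAlgebra k M G) {N : Type*} [AddCommGroup N] [Module k N]

theorem gr_zero : H.gr 0 = Submodule.span k (Set.range H.of) := by
  have h := H.coradically_graded 0
  rw [coradicalFiltration, H.pointed.coradical_eq, ← H.range_of] at h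
  rw [h]
  simp

theorem of_mem_gr_zero (g : G) : H.of g ∈ H.gr 0 := by
  rw [H.gr_zero]
  exact Submodule.subset_span ⟨g, rfl⟩

/-- `M(0)` is spanned by `G`. Structure maps that vanish in positive degree are thus determined by
their values on `G`. -/
theorem hom_ext {a b : M →ₗ[k] N} (h0 : ∀ g, a (H.of g) = b (H.of g))
    (h : ∀ n ≠ 0, ∀ x ∈ H.gr n, a x = b x) : a = b := by
  ext m
  induction m using DirectSum.Decomposition.inductionOn H.gr with
  | zero => simp
  | @homogeneous i x =>
    rcases eq_or_ne i 0 with rfl | hi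
    · obtain ⟨x, hx⟩ := x
      rw [H.gr_zero] at hx
      exact LinearMap.eqOn_span (s := Set.range H.of) (by rintro _ ⟨g, rfl⟩; exact h0 g) hx
    · exact h i hi x x.2
  | add x y hx hy => simp [hx, hy]

theorem linearIndependent_of : LinearIndependent k H.of := by
  have h := linearIndepOn_isGroupLikeElem (R := k) (A := M)
  rw [← H.range_of] at h
  exact h.linearIndependent.comp (fun g => ⟨H.of g, g, rfl⟩)
    (fun a b hab => H.of_injective (congrArg Subtype.val hab))

theorem π_mem (m : M) : H.π m ∈ Submodule.span k (Set.range H.of) := by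
  rw [← H.gr_zero]
  exact Subtype.prop _

theorem π_of_mem {n : ℕ} (hn : n ≠ 0) {x : M} (hx : x ∈ H.gr n) : H.π x = 0 := by
  exact DirectSum.decompose_of_mem_ne H.gr hx hn

theorem π_of (g : G) : H.π (H.of g) = H.of g := by
  exact DirectSum.decompose_of_mem_same H.gr (H.of_mem_gr_zero g)

/-- The coefficient of `g` in the image under the projection `π : M → kG`. -/
noncomputable def coef (g : G) : M →ₗ[k] k :=
  Finsupp.lapply g ∘ₗ H.linearIndependent_of.repr ∘ₗ H.π.codRestrict _ H.π_mem

theorem coef_of [DecidableEq G] (g h : G) : H.coef g (H.of h) = if g = h then 1 else 0 := by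
  have : (H.π.codRestrict _ H.π_mem) (H.of h) = ⟨H.of h, Submodule.subset_span ⟨h, rfl⟩⟩ :=
    Subtype.ext (H.π_of h)
  simp only [coef, LinearMap.comp_apply, this]
  rw [H.linearIndependent_of.repr_eq_single h _ rfl]
  simp [Finsupp.single_apply, eq_comm]

theorem coef_of_mem (g : G) {n : ℕ} (hn : n ≠ 0) {x : M} (hx : x ∈ H.gr n) : H.coef g x = 0 := by
  have : (H.π.codRestrict _ H.π_mem) x = 0 := Subtype.ext (H.π_of_mem hn hx)
  simp [coef, this]

/-- On `G` this is evaluation. In positive degree every summand of the comultiplication has a leg of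
positive degree, which `δ_g` or `δ_h` kills. -/
theorem convL_coef [DecidableEq G] (g h : G) :
    convL (H.coef g) (H.coef h) = if g = h then H.coef g else 0 := by
  refine H.hom_ext (fun e => ?_) fun n hn x hx => ?_
  · rw [convL_groupLike _ _ (H.of_groupLike e)]
    split_ifs with hgh
    · subst hgh
      simp [H.coef_of]
    · simp only [H.coef_of, smul_eq_mul, LinearMap.zero_apply]
      split_ifs <;> simp_all
  · have h1 : ∀ t ∈ ⨆ p : ℕ × ℕ, ⨆ _ : p.1 + p.2 = n, tensorSub (H.gr p.1) (H.gr p.2),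
        TensorProduct.lid k k (TensorProduct.map (H.coef g) (H.coef h) t) = 0 := by
      intro t ht
      suffices hle : ⨆ p : ℕ × ℕ, ⨆ _ : p.1 + p.2 = n, tensorSub (H.gr p.1) (H.gr p.2) ≤
          LinearMap.ker ((TensorProduct.lid k k).toLinearMap ∘ₗ
            TensorProduct.map (H.coef g) (H.coef h)) from hle ht
      refine iSup₂_le ?_
      rintro ⟨p, q⟩ hpq _ ⟨s, rfl⟩
      rw [LinearMap.mem_ker, LinearMap.comp_apply]
      induction s using TensorProduct.induction_on with
      | zero => simp
      | tmul x y =>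
        have : p ≠ 0 ∨ q ≠ 0 := by
          by_contra! hc
          simp_all
        rcases this with h | h
        · simp [H.coef_of_mem g h x.2]
        · simp [H.coef_of_mem _ h y.2]
      | add x y hx hy => simp only [map_add, hx, hy, add_zero]
    have h2 : convL (H.coef g) (H.coef h) x = 0 := h1 _ (H.gr_comul n x hx)
    rw [h2]
    split_ifs
    · rw [H.coef_of_mem g hn hx]
    · rfl

/-- `S` reverses the comultiplication and so preserves group-likes; the axiom for `α`, with `α(g) =
1`, then reads `S(g) g = 1`. -/
theorem S_of (g : G) : H.S (H.of g) = H.of g⁻¹ := by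
  have hg := H.of_groupLike g
  have h1 : IsGroupLikeElem k (H.S (H.of g)) := by
    constructor
    · rw [← LinearMap.comp_apply, H.counit_S, hg.counit_eq_one]
    · rw [← LinearMap.comp_apply, H.comul_S]
      simp [hg.comul_eq_tmul_self]
  have h2 : H.S (H.of g) ∈ Set.range H.of := by
    rw [H.range_of]
    exact h1
  obtain ⟨e, he⟩ := h2
  have h3 := H.S_α (H.of g)
  simp only [insertMid, LinearMap.comp_apply, hg.comul_eq_tmul_self, LinearMap.lTensor_tmul,
    convL_groupLike _ _ hg, LinearMap.id_apply, LinearMap.rTensor_tmul, H.α_of, one_smul,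
    LinearMap.mul'_apply] at h3
  rw [← he, ← H.of_mul, ← H.of_one] at h3
  rw [← he, eq_inv_of_mul_eq_one_left (H.of_injective h3)]

theorem β_of (g : G) : H.β (H.of g) = (((H.cocycle g g⁻¹ g)⁻¹ : kˣ) : k) := by
  have hg := H.of_groupLike g
  have h := H.Φ_S (H.of g)
  simp only [insertMid, LinearMap.comp_apply, hg.comul_eq_tmul_self, LinearMap.lTensor_tmul,
    convL_groupLike _ _ hg, LinearMap.id_apply, LinearMap.rTensor_tmul, H.α_of, one_smul,
    H.S_of, hg.counit_eq_one, TensorProduct.tmul_smul, map_smul, smul_eq_mul] at h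
  rw [Units.val_inv_eq_inv_val]
  exact eq_inv_of_mul_eq_one_left h

theorem coef_comp_S (g : G) : H.coef g ∘ₗ H.S = H.coef g⁻¹ := by
  classical
  refine H.hom_ext (fun h => ?_) fun n hn x hx => ?_
  · simp [H.S_of, H.coef_of, inv_eq_iff_eq_inv, eq_inv_iff_mul_eq_one]
  · simp [H.coef_of_mem _ hn hx, H.coef_of_mem _ hn (H.gr_S n x hx)]

variable [Fintype G] [DecidableEq G]

theorem π_eq (m : M) : H.π m = ∑ g, H.coef g m • H.of g := by
  have : H.π = ∑ g, (H.coef g).smulRight (H.of g) := by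
    refine H.hom_ext (fun h => ?_) fun n hn x hx => ?_
    · simp [LinearMap.sum_apply, H.coef_of, H.π_of]
    · simp [LinearMap.sum_apply, H.coef_of_mem _ hn hx, H.π_of_mem hn hx]
  simpa [LinearMap.sum_apply] using LinearMap.congr_fun this m

theorem sum_coef : ∑ g, H.coef g = counit := by
  refine H.hom_ext (fun h => ?_) fun n hn x hx => ?_
  · simp [LinearMap.sum_apply, H.coef_of, (H.of_groupLike h).counit_eq_one]
  · simp [LinearMap.sum_apply, H.coef_of_mem _ hn hx, H.gr_counit n hn x hx]

/-- This expresses that `π` is multiplicative: on `G` it is the group law, and in positive total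
degree both sides vanish because the multiplication is graded. -/
theorem coef_comp_mul (g : G) :
    H.coef g ∘ₗ LinearMap.mul' k M = ∑ a, tmulForm (H.coef a) (H.coef (a⁻¹ * g)) := by
  apply TensorProduct.ext
  have key : ∀ i, ∀ x ∈ H.gr i, ∀ j, ∀ y ∈ H.gr j, i + j ≠ 0 →
      H.coef g (x * y) = ∑ a, H.coef a x * H.coef (a⁻¹ * g) y := by
    intro i x hx j y hy hij
    rw [H.coef_of_mem g hij (H.gr_mul i j x hx y hy), eq_comm]
    refine Finset.sum_eq_zero fun a _ => ?_
    have : i ≠ 0 ∨ j ≠ 0 := by omega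
    rcases this with h | h
    · simp [H.coef_of_mem a h hx]
    · simp [H.coef_of_mem _ h hy]
  refine H.hom_ext (fun a => H.hom_ext (fun b => ?_) fun n hn x hx => ?_)
    fun n hn x hx => H.hom_ext (fun b => ?_) fun m hm y hy => ?_
  · simp only [LinearMap.compr₂ₛₗ_apply, TensorProduct.mk_apply, LinearMap.comp_apply,
      LinearMap.mul'_apply, ← H.of_mul, H.coef_of, LinearMap.sum_apply, tmulForm_tmul]
    rw [Finset.sum_eq_single a (fun x _ hx => by simp [hx]) (by simp)]
    simp [inv_mul_eq_iff_eq_mul]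
  · simpa [LinearMap.sum_apply] using key 0 _ (H.of_mem_gr_zero a) n x hx (by omega)
  · simpa [LinearMap.sum_apply] using key n x hx 0 _ (H.of_mem_gr_zero b) (by omega)
  · simpa [LinearMap.sum_apply] using key n x hx m y hy (by omega)

/-- The associator lives on `M(0)` in all three arguments, so it is the restricted cocycle extended
by the `δ_g`. Convolution with it will therefore be scalar on bihomogeneous elements. -/
theorem Φ_eq : H.Φ = ∑ a, ∑ b, ∑ c, (H.cocycle a b c : k) •
    tmulForm (H.coef a) (tmulForm (H.coef b) (H.coef c)) := by
  have key : ∀ i, ∀ x ∈ H.gr i, ∀ j, ∀ y ∈ H.gr j, ∀ l, ∀ z ∈ H.gr l, i + j + l ≠ 0 →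
      H.Φ (x ⊗ₜ (y ⊗ₜ z)) = (∑ a, ∑ b, ∑ c, (H.cocycle a b c : k) •
        tmulForm (H.coef a) (tmulForm (H.coef b) (H.coef c))) (x ⊗ₜ (y ⊗ₜ z)) := by
    intro i x hx j y hy l z hz hij
    rw [H.gr_Φ i j l hij x hx y hy z hz, eq_comm]
    simp only [LinearMap.sum_apply, LinearMap.smul_apply, tmulForm_tmul]
    refine Finset.sum_eq_zero fun a _ => Finset.sum_eq_zero fun b _ =>
      Finset.sum_eq_zero fun c _ => ?_
    have : i ≠ 0 ∨ j ≠ 0 ∨ l ≠ 0 := by omega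
    rcases this with h | h | h
    · simp [H.coef_of_mem a h hx]
    · simp [H.coef_of_mem _ h hy]
    · simp [H.coef_of_mem _ h hz]
  apply TensorProduct.ext
  refine H.hom_ext (fun a => TensorProduct.ext ?_) fun i hi x hx => TensorProduct.ext ?_
  · refine H.hom_ext (fun b => H.hom_ext (fun c => ?_) fun l hl z hz => ?_)
      fun j hj y hy => H.hom_ext (fun c => ?_) fun l hl z hz => ?_
    · simp [LinearMap.sum_apply, H.coef_of, cocycle]
    · exact key 0 _ (H.of_mem_gr_zero a) 0 _ (H.of_mem_gr_zero b) l z hz (by omega)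
    · exact key 0 _ (H.of_mem_gr_zero a) j y hy 0 _ (H.of_mem_gr_zero c) (by omega)
    · exact key 0 _ (H.of_mem_gr_zero a) j y hy l z hz (by omega)
  · refine H.hom_ext (fun b => H.hom_ext (fun c => ?_) fun l hl z hz => ?_)
      fun j hj y hy => H.hom_ext (fun c => ?_) fun l hl z hz => ?_
    · exact key i x hx 0 _ (H.of_mem_gr_zero b) 0 _ (H.of_mem_gr_zero c) (by omega)
    · exact key i x hx 0 _ (H.of_mem_gr_zero b) l z hz (by omega)
    · exact key i x hx j y hy 0 _ (H.of_mem_gr_zero c) (by omega)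
    · exact key i x hx j y hy l z hz (by omega)

theorem β_eq : H.β = ∑ g, (((H.cocycle g g⁻¹ g)⁻¹ : kˣ) : k) • H.coef g := by
  refine H.hom_ext (fun g => ?_) fun n hn x hx => ?_
  · simp [LinearMap.sum_apply, H.coef_of, H.β_of]
  · simp [LinearMap.sum_apply, H.coef_of_mem _ hn hx, H.gr_β n hn x hx]

end
end GradedPointedMajidAlgebra
end Majid

/-! ### The bigrading by left and right degree -/

section Majid
open Coalgebra
namespace GradedPointedMajidAlgebra

section
variable {k M G : Type*} [Field k] [NonAssocRing M] [Module k M]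
    [IsScalarTower k M M] [SMulCommClass k M M] [Coalgebra k M] [CommGroup G]
    (H : GradedPointedMajidAlgebra k M G) {N : Type*} [AddCommGroup N] [Module k N]

/-- The projection `m ↦ δ_g(m₁) m₂` of `M` onto its component of left degree `g`. -/
noncomputable def compL (g : G) : M →ₗ[k] M := convL (H.coef g) LinearMap.id

/-- The projection `m ↦ m₁ δ_h(m₂)` of `M` onto its component of right degree `h`. -/
noncomputable def compR (h : G) : M →ₗ[k] M := convR LinearMap.id (H.coef h)

theorem convL_coef_eq (g : G) (T : M →ₗ[k] N) : convL (H.coef g) T = T ∘ₗ H.compL g := by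
  rw [compL, ← comp_convL, LinearMap.comp_id]

theorem convR_coef_eq (h : G) (T : M →ₗ[k] N) : convR T (H.coef h) = T ∘ₗ H.compR h := by
  rw [compR, ← comp_convR, LinearMap.comp_id]

/-- `m` is homogeneous of left degree `g` and right degree `h`. -/
structure IsBi (g h : G) (m : M) : Prop where
  left : H.compL g m = m
  right : H.compR h m = m

theorem compL_compR (g h : G) (m : M) : H.compL g (H.compR h m) = H.compR h (H.compL g m) := by
  have h1 := convL_convR (H.coef g) LinearMap.id (H.coef h)
  rw [H.convL_coef_eq, H.convR_coef_eq, H.convR_coef_eq, H.convL_coef_eq] at h1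
  simpa using (LinearMap.congr_fun h1 m).symm

theorem counit_compL (g : G) (m : M) : counit (R := k) (H.compL g m) = H.coef g m := by
  have h1 := H.convL_coef_eq g counit
  rw [← convR_eq_convL, convR_counit] at h1
  exact (LinearMap.congr_fun h1 m).symm

theorem counit_compR (g : G) (m : M) : counit (R := k) (H.compR g m) = H.coef g m := by
  have h1 := H.convR_coef_eq g counit
  rw [convR_eq_convL, convL_counit] at h1
  exact (LinearMap.congr_fun h1 m).symm

theorem lTensor_compL_comul (e : G) (m : M) :
    (H.compL e).lTensor M (comul m) = (H.compR e).rTensor M (comul m) :=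
  LinearMap.congr_fun (lTensor_convL_comul (H.coef e)) m

theorem comul_compL (e : G) (m : M) :
    comul (H.compL e m) = (H.compL e).rTensor M (comul m) :=
  LinearMap.congr_fun (comul_comp_convL (H.coef e)) m

theorem comul_compR (e : G) (m : M) :
    comul (H.compR e m) = (H.compR e).lTensor M (comul m) :=
  LinearMap.congr_fun (comul_comp_convR (H.coef e)) m

variable {H} in
theorem IsBi.smul {g h : G} {m : M} (hm : H.IsBi g h m) (a : k) : H.IsBi g h (a • m) :=
  ⟨by rw [map_smul, hm.left], by rw [map_smul, hm.right]⟩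

variable {H} in
-- `S` is an anti-coalgebra map and `δ_g ∘ S = δ_{g⁻¹}`, so the two degrees are swapped and
-- inverted.
theorem IsBi.S {g h : G} {m : M} (hm : H.IsBi g h m) : H.IsBi h⁻¹ g⁻¹ (H.S m) := by
  constructor
  · have h1 := convL_comp_anti H.comul_S (H.coef h⁻¹) LinearMap.id
    rw [H.coef_comp_S, inv_inv, H.convR_coef_eq, LinearMap.id_comp] at h1
    have h2 := LinearMap.congr_fun h1 m
    rw [LinearMap.comp_apply, LinearMap.comp_apply, hm.right] at h2
    exact h2
  · have h1 := convR_comp_anti H.comul_S (H.coef g⁻¹) LinearMap.id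
    rw [H.coef_comp_S, inv_inv, H.convL_coef_eq, LinearMap.id_comp] at h1
    have h2 := LinearMap.congr_fun h1 m
    rw [LinearMap.comp_apply, LinearMap.comp_apply, hm.left] at h2
    exact h2

variable [DecidableEq G]

theorem compL_compL (g h : G) (m : M) :
    H.compL g (H.compL h m) = if g = h then H.compL h m else 0 := by
  have h1 := convL_convL (H.coef h) (H.coef g) LinearMap.id
  rw [H.convL_coef_eq g, H.convL_coef_eq h, H.convL_coef] at h1
  have h2 := LinearMap.congr_fun h1 m
  simp only [LinearMap.comp_apply, LinearMap.id_apply] at h2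
  rw [h2]
  split_ifs with h3 h4 h4
  · rfl
  · exact absurd h3.symm h4
  · exact absurd h4.symm h3
  · simp [convL]

theorem compR_compR (g h : G) (m : M) :
    H.compR g (H.compR h m) = if g = h then H.compR h m else 0 := by
  have h1 := convR_convR LinearMap.id (H.coef g) (H.coef h)
  rw [H.convR_coef_eq g, H.convR_coef_eq h, H.convL_coef] at h1
  have h2 := LinearMap.congr_fun h1 m
  simp only [LinearMap.comp_apply, LinearMap.id_apply] at h2
  rw [h2]
  split_ifs with h3
  · subst h3
    rfl
  · simp [convR]

theorem isBi_comp (g h : G) (m : M) : H.IsBi g h (H.compL g (H.compR h m)) := by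
  constructor
  · simp [H.compL_compL]
  · simp [H.compL_compR, H.compR_compR]

theorem isBi_of (g : G) : H.IsBi g g (H.of g) := by
  constructor
  · rw [compL, convL_groupLike _ _ (H.of_groupLike g)]
    simp [H.coef_of]
  · rw [compR, convR_groupLike _ _ (H.of_groupLike g)]
    simp [H.coef_of]

theorem isBi_one : H.IsBi 1 1 (1 : M) := by
  rw [← H.of_one]
  exact H.isBi_of 1

variable {H}

theorem IsBi.compL_eq {g h : G} {m : M} (hm : H.IsBi g h m) (e : G) :
    H.compL e m = if e = g then m else 0 := by
  have := H.compL_compL e g m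
  rwa [hm.left] at this

theorem IsBi.compR_eq {g h : G} {m : M} (hm : H.IsBi g h m) (e : G) :
    H.compR e m = if e = h then m else 0 := by
  have := H.compR_compR e h m
  rwa [hm.right] at this

theorem IsBi.coef_eq_left {g h : G} {m : M} (hm : H.IsBi g h m) (e : G) :
    H.coef e m = if e = g then counit (R := k) m else 0 := by
  rw [← H.counit_compL, hm.compL_eq]
  split_ifs <;> simp

theorem IsBi.coef_eq_right {g h : G} {m : M} (hm : H.IsBi g h m) (e : G) :
    H.coef e m = if e = h then counit (R := k) m else 0 := by
  rw [← H.counit_compR, hm.compR_eq]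
  split_ifs <;> simp

/-- The value `δ_g(m)` can be read from either degree: the left one gives `ε(m)`, the right one
gives `0`. -/
theorem IsBi.counit_eq_zero {g h : G} {m : M} (hm : H.IsBi g h m) (hgh : g ≠ h) :
    counit (R := k) m = 0 := by
  have h1 := hm.coef_eq_left g
  rw [hm.coef_eq_right g, if_neg hgh, if_pos rfl] at h1
  exact h1.symm

variable (H) [Fintype G]

theorem sum_compL (m : M) : ∑ g, H.compL g m = m := by
  have h := convL_sum_left Finset.univ H.coef (LinearMap.id : M →ₗ[k] M)
  rw [H.sum_coef, convL_counit] at h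
  simpa [LinearMap.sum_apply, compL, compR] using (LinearMap.congr_fun h m).symm

theorem sum_compR (m : M) : ∑ g, H.compR g m = m := by
  have h := convR_sum_right Finset.univ H.coef (LinearMap.id : M →ₗ[k] M)
  rw [H.sum_coef, convR_counit] at h
  simpa [LinearMap.sum_apply, compL, compR] using (LinearMap.congr_fun h m).symm

theorem hom_ext_isBi {a b : M →ₗ[k] N} (h : ∀ g h m, H.IsBi g h m → a m = b m) : a = b := by
  ext m
  rw [← H.sum_compR m, map_sum, map_sum]
  refine Finset.sum_congr rfl fun e _ => ?_
  rw [← H.sum_compL (H.compR e m), map_sum, map_sum]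
  exact Finset.sum_congr rfl fun g _ => h g e _ (H.isBi_comp g e m)

theorem compL_mul (g : G) (x y : M) :
    H.compL g (x * y) = ∑ a, H.compL a x * H.compL (a⁻¹ * g) y := by
  have h := convL_comp_coalgebra H.comul_mul (H.coef g) LinearMap.id
  rw [H.coef_comp_mul, convL_sum_left, LinearMap.id_comp] at h
  simp only [convL_tmulForm] at h
  simpa [LinearMap.sum_apply, compL, compR] using LinearMap.congr_fun h (x ⊗ₜ y)

theorem compR_mul (g : G) (x y : M) :
    H.compR g (x * y) = ∑ a, H.compR a x * H.compR (a⁻¹ * g) y := by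
  have h := convR_comp_coalgebra H.comul_mul (H.coef g) LinearMap.id
  rw [H.coef_comp_mul, convR_sum_right, LinearMap.id_comp] at h
  simp only [convR_tmulForm] at h
  simpa [LinearMap.sum_apply, compL, compR] using LinearMap.congr_fun h (x ⊗ₜ y)

variable {H}

theorem IsBi.mul {a b c d : G} {x y : M} (hx : H.IsBi a b x) (hy : H.IsBi c d y) :
    H.IsBi (a * c) (b * d) (x * y) := by
  constructor
  · rw [H.compL_mul, Finset.sum_eq_single a (fun e _ he => by simp [hx.compL_eq, he]) (by simp)]
    simp [hx.left, hy.left]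
  · rw [H.compR_mul, Finset.sum_eq_single b (fun e _ he => by simp [hx.compR_eq, he]) (by simp)]
    simp [hx.right, hy.right]

/-- In the quasi-associativity axiom `Φ` is convolved on the right of `x(yz)` and on the left of
`(xy)z`. It therefore sees the right degrees in the first case and the left degrees in the second.
-/
theorem IsBi.mul_assoc' {a b c a' b' c' : G} {x y z : M} (hx : H.IsBi a a' x) (hy : H.IsBi b b' y)
    (hz : H.IsBi c c' z) :
    (H.cocycle a' b' c' : k) • (x * (y * z)) = (H.cocycle a b c : k) • ((x * y) * z) := by
  have h := LinearMap.congr_fun H.quasi_assoc (x ⊗ₜ (y ⊗ₜ z))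
  rw [H.Φ_eq] at h
  simp only [convL_sum_left, convR_sum_right, convL_smul_left, convR_smul_right, convL_tmulForm,
    convR_tmulForm, LinearMap.sum_apply, LinearMap.smul_apply, LinearMap.comp_apply,
    TensorProduct.map_tmul] at h
  change ∑ e, ∑ f, ∑ g, (H.cocycle e f g : k) • (LinearMap.mul' k M)
      ((LinearMap.mul' k M).lTensor M (H.compR e x ⊗ₜ (H.compR f y ⊗ₜ H.compR g z))) =
    ∑ e, ∑ f, ∑ g, (H.cocycle e f g : k) • (LinearMap.mul' k M)
      ((LinearMap.mul' k M).rTensor M ((TensorProduct.assoc k M M M).symm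
        (H.compL e x ⊗ₜ (H.compL f y ⊗ₜ H.compL g z)))) at h
  -- Only the summand indexed by the actual degrees survives in each of the six sums.
  rw [Finset.sum_eq_single a' (fun e _ he => by simp [hx.compR_eq, he]) (by simp),
    Finset.sum_eq_single b' (fun e _ he => by simp [hy.compR_eq, he]) (by simp),
    Finset.sum_eq_single c' (fun e _ he => by simp [hz.compR_eq, he]) (by simp),
    Finset.sum_eq_single a (fun e _ he => by simp [hx.compL_eq, he]) (by simp),
    Finset.sum_eq_single b (fun e _ he => by simp [hy.compL_eq, he]) (by simp),
    Finset.sum_eq_single c (fun e _ he => by simp [hz.compL_eq, he]) (by simp)] at h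
  simpa [hx.left, hx.right, hy.left, hy.right, hz.left, hz.right] using h

theorem IsBi.assoc_eq {a b c a' b' c' : G} {x y z : M} (hx : H.IsBi a a' x) (hy : H.IsBi b b' y)
    (hz : H.IsBi c c' z) :
    (x * y) * z = ((H.cocycle a' b' c' / H.cocycle a b c : kˣ) : k) • (x * (y * z)) := by
  rw [div_eq_inv_mul, Units.val_mul, mul_smul, hx.mul_assoc' hy hz, smul_smul]
  simp

variable (H)

theorem rTensor_π_comul (m : M) :
    H.π.rTensor M (comul m) = ∑ g, H.of g ⊗ₜ[k] H.compL g m := by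
  simp only [compL, convL, LinearMap.comp_apply]
  induction (comul m : M ⊗[k] M) using TensorProduct.induction_on with
  | zero => simp
  | tmul x y => simp [H.π_eq, TensorProduct.sum_tmul, TensorProduct.smul_tmul]
  | add x y hx hy => simp only [map_add, TensorProduct.tmul_add, Finset.sum_add_distrib, hx, hy]

theorem lTensor_π_comul (m : M) :
    H.π.lTensor M (comul m) = ∑ g, H.compR g m ⊗ₜ[k] H.of g := by
  simp only [compR, convR, LinearMap.comp_apply]
  induction (comul m : M ⊗[k] M) using TensorProduct.induction_on with
  | zero => simp
  | tmul x y => simp [H.π_eq, TensorProduct.tmul_sum, TensorProduct.smul_tmul]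
  | add x y hx hy => simp only [map_add, TensorProduct.add_tmul, Finset.sum_add_distrib, hx, hy]

/-- Applying `δ_g ⊗ id` recovers the projection from the coaction; conversely, orthogonality of the
projections leaves one term of the coaction. This connects the conditions stated with `π` to the
projections. -/
theorem rTensor_π_comul_eq_iff (g : G) (m : M) :
    H.π.rTensor M (comul m) = H.of g ⊗ₜ[k] m ↔ H.compL g m = m := by
  rw [H.rTensor_π_comul]
  constructor
  · intro h
    have h1 := congrArg ((TensorProduct.lid k M).toLinearMap ∘ₗ (H.coef g).rTensor M) h
    simpa [H.coef_of] using h1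
  · intro h
    rw [Finset.sum_eq_single g (fun e _ he => by rw [← h, H.compL_compL, if_neg he]; simp)
      (by simp), h]

theorem lTensor_π_comul_eq_iff (g : G) (m : M) :
    H.π.lTensor M (comul m) = m ⊗ₜ[k] H.of g ↔ H.compR g m = m := by
  rw [H.lTensor_π_comul]
  constructor
  · intro h
    have h1 := congrArg ((TensorProduct.rid k M).toLinearMap ∘ₗ (H.coef g).lTensor M) h
    simpa [H.coef_of] using h1
  · intro h
    rw [Finset.sum_eq_single g (fun e _ he => by rw [← h, H.compR_compR, if_neg he]; simp)
      (by simp), h]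

theorem mem_biComp {g h : G} {m : M} : m ∈ H.biComp g h ↔ H.IsBi g h m := by
  simp only [biComp, Submodule.mem_inf, LinearMap.mem_eqLocus, LinearMap.comp_apply,
    TensorProduct.mk_apply, LinearMap.flip_apply]
  rw [H.rTensor_π_comul_eq_iff, H.lTensor_π_comul_eq_iff]
  exact ⟨fun h => ⟨h.1, h.2⟩, fun h => ⟨h.1, h.2⟩⟩

theorem mem_coinv {m : M} : m ∈ H.coinv ↔ H.compR 1 m = m := by
  rw [← H.lTensor_π_comul_eq_iff, H.of_one]
  rfl

end
end GradedPointedMajidAlgebra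
end Majid

/-- The cocycle condition at `(g, h, h⁻¹, h)`, in which two factors have an entry `1`. It reconciles
the scalar in the formula for the action with the one in the formula for the comultiplication. -/
theorem ThreeCocycle.mul_inv_cancel_right {G k : Type*} [CommGroup G] [Field k]
    (φ : ThreeCocycle G k) (g h : G) :
    φ (g * h) h⁻¹ h = φ g h h⁻¹ * φ h h⁻¹ h := by
  have := φ.cocycle g h h⁻¹ h
  simpa [φ.normalized, φ.one_right] using this

/-! ### The coinvariants as a Yetter-Drinfeld module -/

section Majid
open Coalgebra
namespace GradedPointedMajidAlgebra

section
variable {k M G : Type*} [Field k] [NonAssocRing M] [Module k M]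
    [IsScalarTower k M M] [SMulCommClass k M M] [Coalgebra k M] [CommGroup G] [Fintype G]
    [DecidableEq G] {H : GradedPointedMajidAlgebra k M G} {N : Type*} [AddCommGroup N] [Module k N]

theorem IsBi.assoc_symm_eq {a b c a' b' c' : G} {x y z : M} (hx : H.IsBi a a' x)
    (hy : H.IsBi b b' y) (hz : H.IsBi c c' z) :
    x * (y * z) = ((H.cocycle a b c / H.cocycle a' b' c' : kˣ) : k) • ((x * y) * z) := by
  rw [hx.assoc_eq hy hz, smul_smul, ← Units.val_mul]
  simp

variable (H)

/-- The map which sends `X · h`, for `X ∈ R` and `h ∈ G`, to `X`. -/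
noncomputable def strip : M →ₗ[k] M :=
  ∑ g, ∑ h, (H.cocycle (g * h⁻¹) h h⁻¹ : k) •
    (LinearMap.mulRight k (H.of h⁻¹) ∘ₗ H.compL g ∘ₗ H.compR h)

variable {H}

theorem IsBi.strip_eq {g h : G} {m : M} (hm : H.IsBi g h m) :
    H.strip m = (H.cocycle (g * h⁻¹) h h⁻¹ : k) • (m * H.of h⁻¹) := by
  simp only [strip, LinearMap.sum_apply, LinearMap.smul_apply, LinearMap.comp_apply,
    LinearMap.mulRight_apply, hm.compR_eq]
  rw [Finset.sum_eq_single g, Finset.sum_eq_single h]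
  · simp [hm.left]
  · intro b _ hb
    simp [hb]
  · simp
  · intro b _ hb
    refine Finset.sum_eq_zero fun e _ => ?_
    split_ifs <;> simp [hm.compL_eq, hb]
  · simp

theorem IsBi.strip {g h : G} {m : M} (hm : H.IsBi g h m) :
    H.IsBi (g * h⁻¹) 1 (H.strip m) := by
  rw [hm.strip_eq]
  simpa using (hm.mul (H.isBi_of h⁻¹)).smul (H.cocycle (g * h⁻¹) h h⁻¹ : k)

/-- Reassociating `(m · h⁻¹) · h` costs `Φ(h, h⁻¹, h) / Φ(g, h⁻¹, h)`, which the scalar of `strip`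
cancels by the preceding cocycle identity. -/
theorem IsBi.strip_mul_of {g h : G} {m : M} (hm : H.IsBi g h m) : H.strip m * H.of h = m := by
  have h1 := H.cocycle.mul_inv_cancel_right (g * h⁻¹) h
  rw [inv_mul_cancel_right] at h1
  rw [hm.strip_eq, smul_mul_assoc, hm.assoc_eq (H.isBi_of _) (H.isBi_of _), ← H.of_mul,
    smul_smul, ← Units.val_mul, h1, inv_mul_cancel, H.of_one, mul_one]
  simp

/-- Here lies the origin of the scalar in `strip`: since `X` has right degree `1`, `(X · h) · h⁻¹ =
Φ(x, h, h⁻¹)⁻¹ X`. -/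
theorem IsBi.strip_mul {x : G} {X : M} (hX : H.IsBi x 1 X) (h : G) :
    H.strip (X * H.of h) = X := by
  have h1 := hX.mul (H.isBi_of h)
  rw [one_mul] at h1
  rw [h1.strip_eq, hX.assoc_eq (H.isBi_of _) (H.isBi_of _), ← H.of_mul, smul_smul,
    ← Units.val_mul, mul_inv_cancel_right, mul_inv_cancel, H.of_one, mul_one,
    ThreeCocycle.one_left]
  simp

theorem IsBi.strip_self {x : G} {X : M} (hX : H.IsBi x 1 X) : H.strip X = X := by
  simpa [H.of_one] using hX.strip_mul 1

/-- The test for equality in `R`: multiply by a group element, where the relation `(f ▷ X) · f = f ·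
X` is available. -/
theorem IsBi.mul_of_cancel {x y : G} {X Y : M} (hX : H.IsBi x 1 X) (hY : H.IsBi y 1 Y) {h : G}
    (hXY : X * H.of h = Y * H.of h) : X = Y := by
  rw [← hX.strip_mul h, hXY, hY.strip_mul]

variable (H)

theorem strip_mem_coinv (m : M) : H.strip m ∈ H.coinv := by
  have : H.compR 1 ∘ₗ H.strip = H.strip :=
    H.hom_ext_isBi fun g h m hm => hm.strip.right
  rw [H.mem_coinv, ← LinearMap.comp_apply, this]

/-- The projection `M = ⨁ R · h → R` which sends `X · h` to `X`. -/
noncomputable def toCoinv : M →ₗ[k] H.coinv := H.strip.codRestrict _ H.strip_mem_coinv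

@[simp]
theorem coe_toCoinv (m : M) : (H.toCoinv m : M) = H.strip m := rfl

theorem compL_mem_coinv (g : G) {m : M} (hm : m ∈ H.coinv) : H.compL g m ∈ H.coinv := by
  rw [H.mem_coinv] at hm ⊢
  rw [← H.compL_compR, hm]

variable {H} in
theorem isBi_one_iff_of_coinv {g : G} (X : H.coinv) :
    H.IsBi g 1 (X : M) ↔ H.compL g X = (X : M) :=
  ⟨fun h => h.left, fun h => ⟨h, H.mem_coinv.1 X.2⟩⟩

variable {H} in
theorem IsBi.mem_coinv {g : G} {X : M} (h : H.IsBi g 1 X) : X ∈ H.coinv :=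
  H.mem_coinv.2 h.right

theorem isBi_compL_coinv (g : G) (X : H.coinv) : H.IsBi g 1 (H.compL g (X : M)) := by
  have := H.isBi_comp g 1 (X : M)
  rwa [H.mem_coinv.1 X.2] at this

variable {H} in
-- Commutativity of `G` enters here: the left degree `fx` equals `xf`, so stripping `f` off on the
-- right returns to degree `x`.
theorem IsBi.of_mul {x : G} {X : M} (hX : H.IsBi x 1 X) (f : G) :
    H.IsBi (x * f) f (H.of f * X) := by
  simpa [mul_comm x f] using (H.isBi_of f).mul hX

variable {H} in
theorem IsBi.strip_of_mul {x : G} {X : M} (hX : H.IsBi x 1 X) (f : G) :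
    H.IsBi x 1 (H.strip (H.of f * X)) := by
  simpa using (hX.of_mul f).strip

variable {H} in
-- After multiplication by `ef`, the element `e ▷ (f ▷ X)` is carried to `(ef) · X` by three
-- reassociations, of `(Y, e, f)`, `(e, f ▷ X, f)` and `(e, f, X)` with `Y = e ▷ (f ▷ X)`. They
-- contribute `Φ(x, e, f)`, `Φ(e, x, f)⁻¹` and `Φ(e, f, x)`, which are the three factors of `Φ̃_x(e,
-- f)`.
theorem IsBi.strip_of_mul_strip_of_mul {x : G} {X : M} (hX : H.IsBi x 1 X) (e f : G) :
    H.strip (H.of e * H.strip (H.of f * X)) =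
      (H.cocycle.tw x e f : k) • H.strip (H.of (e * f) * X) := by
  have hZ := hX.strip_of_mul f
  have hY := hZ.strip_of_mul e
  refine hY.mul_of_cancel (h := e * f) ((hX.strip_of_mul (e * f)).smul _) ?_
  rw [smul_mul_assoc, (hX.of_mul (e * f)).strip_mul_of, H.of_mul,
    hY.assoc_symm_eq (H.isBi_of e) (H.isBi_of f), (hZ.of_mul e).strip_mul_of,
    (H.isBi_of e).assoc_eq hZ (H.isBi_of f), (hX.of_mul f).strip_mul_of,
    (H.isBi_of e).assoc_symm_eq (H.isBi_of f) hX, smul_smul, smul_smul, ← Units.val_mul,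
    ← Units.val_mul, ThreeCocycle.one_left, ThreeCocycle.one_right, ThreeCocycle.normalized,
    ThreeCocycle.tw]
  congr 2
  apply Additive.ofMul.injective
  simp only [ofMul_mul, ofMul_div, ofMul_one]
  abel

theorem coinv_ext {a b : H.coinv →ₗ[k] N}
    (h : ∀ g (X : H.coinv), H.IsBi g 1 (X : M) → a X = b X) : a = b := by
  ext X
  have h1 : X = ∑ g, (⟨_, H.compL_mem_coinv g X.2⟩ : H.coinv) := by
    apply Subtype.ext
    simp [H.sum_compL]
  rw [h1, map_sum, map_sum]
  exact Finset.sum_congr rfl fun g _ => h g _ (H.isBi_compL_coinv g X)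

theorem strip_coinv (X : H.coinv) : H.strip (X : M) = X := by
  have : H.strip ∘ₗ H.coinv.subtype = H.coinv.subtype :=
    H.coinv_ext fun g X hX => hX.strip_self
  exact LinearMap.congr_fun this X

/-- The structure of a Yetter-Drinfeld module on `R`. -/
noncomputable def coinvYD : YDModule H.cocycle H.coinv where
  proj g := (H.compL g).restrict fun _ h => H.compL_mem_coinv g h
  act f := H.toCoinv ∘ₗ LinearMap.mulLeft k (H.of f) ∘ₗ H.coinv.subtype
  proj_proj g h v := by
    apply Subtype.ext
    simp only [LinearMap.coe_restrict_apply, H.compL_compL]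
    split_ifs <;> rfl
  sum_proj v := by
    apply Subtype.ext
    simp [H.sum_compL]
  proj_act g f v := by
    have : H.compL g ∘ₗ H.strip ∘ₗ LinearMap.mulLeft k (H.of f) ∘ₗ H.coinv.subtype =
        H.strip ∘ₗ LinearMap.mulLeft k (H.of f) ∘ₗ H.compL g ∘ₗ H.coinv.subtype := by
      refine H.coinv_ext fun x X hX => ?_
      simp only [LinearMap.comp_apply, LinearMap.mulLeft_apply, Submodule.subtype_apply,
        (hX.strip_of_mul f).compL_eq, hX.compL_eq]
      split_ifs <;> simp
    exact Subtype.ext (LinearMap.congr_fun this v)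
  act_one v := by
    apply Subtype.ext
    simp [H.of_one, H.strip_coinv]
  act_act e f g v := Subtype.ext (H.isBi_compL_coinv g v |>.strip_of_mul_strip_of_mul e f)

theorem coe_coinvYD_act (f : G) (X : H.coinv) :
    (H.coinvYD.act f X : M) = H.strip (H.of f * X) := rfl

theorem coinvYD_isHom {g : G} {X : H.coinv} : H.coinvYD.IsHom g X ↔ H.IsBi g 1 (X : M) := by
  rw [isBi_one_iff_of_coinv]
  exact Subtype.ext_iff

variable {H} in
-- The defining property of the action, through which all its properties are derived; the explicit
-- formula is needed only for the final statement.
theorem IsBi.act_mul_of {g : G} {X : H.coinv} (hX : H.IsBi g 1 (X : M)) (f : G) :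
    (H.coinvYD.act f X : M) * H.of f = H.of f * X :=
  (hX.of_mul f).strip_mul_of

variable {H} in
theorem IsBi.act {g : G} {X : H.coinv} (hX : H.IsBi g 1 (X : M)) (f : G) :
    H.IsBi g 1 (H.coinvYD.act f X : M) := hX.strip_of_mul f

variable {H} in
theorem IsBi.act_eq {g : G} {X : H.coinv} (hX : H.IsBi g 1 (X : M)) (f : G) :
    (H.coinvYD.act f X : M) = ((H.cocycle (f * g) f⁻¹ f / H.cocycle f f⁻¹ f : kˣ) : k) •
      ((H.of f * (X : M)) * H.of f⁻¹) := by
  rw [H.coe_coinvYD_act, (hX.of_mul f).strip_eq, mul_comm f g,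
    H.cocycle.mul_inv_cancel_right, mul_div_cancel_right, mul_inv_cancel_right]

end
end GradedPointedMajidAlgebra
end Majid

/-! ### The structure maps of `R` and the embedding of `R ⊗ R` into `M ⊗ M` -/

section Majid
open Coalgebra
namespace GradedPointedMajidAlgebra

section
variable {k M G : Type*} [Field k] [NonAssocRing M] [Module k M]
    [IsScalarTower k M M] [SMulCommClass k M M] [Coalgebra k M] [CommGroup G]
    {H : GradedPointedMajidAlgebra k M G} {N : Type*} [AddCommGroup N] [Module k N]

theorem comul_mul_eq (H : GradedPointedMajidAlgebra k M G) (x y : M) : (comul (x * y) : M ⊗[k] M) = comul x * comul y := by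
  have h := LinearMap.congr_fun H.comul_mul (x ⊗ₜ y)
  simp only [LinearMap.comp_apply, LinearMap.mul'_apply, TensorProduct.comul_tmul] at h
  rw [h]
  generalize (comul x : M ⊗[k] M) = s
  generalize (comul y : M ⊗[k] M) = t
  induction s using TensorProduct.induction_on with
  | zero => simp
  | tmul a b =>
    induction t using TensorProduct.induction_on with
    | zero => simp
    | tmul c d => simp
    | add c d hc hd => simp only [TensorProduct.tmul_add, map_add, hc, hd, mul_add]
  | add a b ha hb => simp only [TensorProduct.add_tmul, map_add, ha, hb, add_mul]

theorem counit_mul_eq (H : GradedPointedMajidAlgebra k M G) (x y : M) :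
    counit (R := k) (x * y) = counit (R := k) x * counit (R := k) y := by
  have h := LinearMap.congr_fun H.counit_mul (x ⊗ₜ y)
  simpa [mul_comm] using h

variable (H) in
theorem comul_of (g : G) : (comul (H.of g) : M ⊗[k] M) = H.of g ⊗ₜ H.of g :=
  (H.of_groupLike g).comul_eq_tmul_self

variable (H) in
theorem counit_of (g : G) : counit (R := k) (H.of g) = 1 := (H.of_groupLike g).counit_eq_one

variable (H)

/-- The counit of `R`. -/
noncomputable def coinvCounit : H.coinv →ₗ[k] k := counit ∘ₗ H.coinv.subtype

@[simp]
theorem coinvCounit_apply (X : H.coinv) : H.coinvCounit X = counit (R := k) (X : M) := rfl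

variable {H}

variable [Fintype G] [DecidableEq G]

variable (H) in
-- A linear left inverse is produced, and not injectivity alone, so that it can be tensored with
-- itself in the next lemma.
theorem mul_of_injective (f : G) : ∃ l : M →ₗ[k] M, ∀ m, l (m * H.of f) = m := by
  -- In bidegree `(g, h)` one has `(m · f) · f⁻¹ = Φ(h, f, f⁻¹) / Φ(g, f, f⁻¹) m`; the coefficients
  -- are the inverse scalars, and `m · f` has bidegree `(gf, hf)`.
  refine ⟨∑ g, ∑ h, ((H.cocycle g f f⁻¹ / H.cocycle h f f⁻¹ : kˣ) : k) •
    (LinearMap.mulRight k (H.of f⁻¹) ∘ₗ H.compL (g * f) ∘ₗ H.compR (h * f)), fun m => ?_⟩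
  rw [← LinearMap.mulRight_apply (R := k), ← LinearMap.comp_apply]
  conv_rhs => rw [← LinearMap.id_apply (R := k) m]
  revert m
  rw [← LinearMap.ext_iff]
  refine H.hom_ext_isBi fun g h m hm => ?_
  simp only [LinearMap.sum_apply, LinearMap.smul_apply, LinearMap.comp_apply,
    LinearMap.mulRight_apply, (hm.mul (H.isBi_of f)).compR_eq]
  rw [Finset.sum_eq_single g, Finset.sum_eq_single h]
  · rw [if_pos rfl, (hm.mul (H.isBi_of f)).left, hm.assoc_eq (H.isBi_of _) (H.isBi_of _),
      smul_smul, ← Units.val_mul, ← H.of_mul, mul_inv_cancel, H.of_one]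
    simp
  · intro b _ hb
    simp [hb]
  · simp
  · intro b _ hb
    refine Finset.sum_eq_zero fun e _ => ?_
    split_ifs <;> simp [(hm.mul (H.isBi_of f)).compL_eq, hb]
  · simp

variable (H) in
theorem mul_of_tmul_of_injective (f : G) :
    Function.Injective fun t : M ⊗[k] M => t * (H.of f ⊗ₜ H.of f) := by
  obtain ⟨l, hl⟩ := H.mul_of_injective f
  refine Function.LeftInverse.injective (g := TensorProduct.map l l) fun t => ?_
  induction t using TensorProduct.induction_on with
  | zero => simp
  | tmul x y => simp [hl]
  | add x y hx hy => simp only [add_mul, map_add, hx, hy]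

variable (H)

/-- The multiplication of `R`. -/
noncomputable def coinvMul : H.coinv ⊗[k] H.coinv →ₗ[k] H.coinv :=
  (LinearMap.mul' k M ∘ₗ TensorProduct.map H.coinv.subtype H.coinv.subtype).codRestrict _ <| by
    intro t
    rw [H.mem_coinv, ← LinearMap.comp_apply (H.compR 1)]
    refine LinearMap.congr_fun ?_ t
    refine H.coinvYD.ext_tmul H.coinvYD fun x y X Y hX hY => ?_
    rw [coinvYD_isHom] at hX hY
    simpa using (hX.mul hY).right

@[simp]
theorem coe_coinvMul_tmul (X Y : H.coinv) : (H.coinvMul (X ⊗ₜ Y) : M) = (X : M) * Y := rfl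

/-- The unit of `R`. -/
noncomputable def coinvOne : k →ₗ[k] H.coinv :=
  LinearMap.toSpanSingleton k _ ⟨1, H.isBi_one.mem_coinv⟩

@[simp]
theorem coe_coinvOne (a : k) : (H.coinvOne a : M) = a • (1 : M) := rfl

/-- The comultiplication of `R`. -/
noncomputable def coinvComul : H.coinv →ₗ[k] H.coinv ⊗[k] H.coinv :=
  TensorProduct.map H.toCoinv H.toCoinv ∘ₗ comul ∘ₗ H.coinv.subtype

/-- The embedding `X ⊗ Y ↦ X · y ⊗ Y`, for `Y` of degree `y`, which turns the comultiplication
of `R` into that of `M`. -/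
noncomputable def unstrip : H.coinv ⊗[k] H.coinv →ₗ[k] M ⊗[k] M :=
  ∑ b, TensorProduct.map (LinearMap.mulRight k (H.of b) ∘ₗ H.coinv.subtype)
    (H.compL b ∘ₗ H.coinv.subtype)

variable {H}

theorem IsBi.unstrip_tmul (X : H.coinv) {Y : H.coinv} {y : G} (hY : H.IsBi y 1 (Y : M)) :
    H.unstrip (X ⊗ₜ Y) = ((X : M) * H.of y) ⊗ₜ (Y : M) := by
  simp only [unstrip, LinearMap.sum_apply, TensorProduct.map_tmul, LinearMap.comp_apply,
    Submodule.subtype_apply, hY.compL_eq, LinearMap.mulRight_apply]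
  rw [Finset.sum_eq_single y (fun b _ hb => by simp [hb]) (by simp)]
  simp

variable (H)

theorem coinv_tmul_ext {a b : H.coinv ⊗[k] H.coinv →ₗ[k] N}
    (h : ∀ x y (X Y : H.coinv), H.IsBi x 1 (X : M) → H.IsBi y 1 (Y : M) →
      a (X ⊗ₜ Y) = b (X ⊗ₜ Y)) : a = b :=
  H.coinvYD.ext_tmul H.coinvYD fun x y X Y hX hY =>
    h x y X Y (coinvYD_isHom H |>.1 hX) (coinvYD_isHom H |>.1 hY)

theorem toCoinv_unstrip (t : H.coinv ⊗[k] H.coinv) :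
    TensorProduct.map H.toCoinv H.toCoinv (H.unstrip t) = t := by
  refine LinearMap.congr_fun (f := TensorProduct.map H.toCoinv H.toCoinv ∘ₗ H.unstrip)
    (g := LinearMap.id) (H.coinv_tmul_ext fun x y X Y hX hY => ?_) t
  rw [LinearMap.comp_apply, hY.unstrip_tmul, TensorProduct.map_tmul, LinearMap.id_apply]
  congr 1
  · exact Subtype.ext (hX.strip_mul y)
  · exact Subtype.ext hY.strip_self

theorem unstrip_injective : Function.Injective H.unstrip :=
  Function.LeftInverse.injective H.toCoinv_unstrip

/-- Degrees match in the middle of `Δ(X)`, and its second leg has right degree `1`. So `Δ(X)` lies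
in the sum over `e` of the tensors whose first leg has right degree `e` and whose second leg has
bidegree `(e, 1)`; on these `unstrip` inverts `strip ⊗ strip`. -/
theorem unstrip_coinvComul (X : H.coinv) : H.unstrip (H.coinvComul X) = comul (X : M) := by
  have key : ∀ e, (H.unstrip ∘ₗ TensorProduct.map H.toCoinv H.toCoinv) ∘ₗ
      TensorProduct.map (H.compR e) (H.compL e ∘ₗ H.compR 1) =
      TensorProduct.map (H.compR e) (H.compL e ∘ₗ H.compR 1) := by
    intro e
    apply TensorProduct.ext
    refine H.hom_ext_isBi fun g h m hm => ?_
    ext n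
    have hn := H.isBi_comp e 1 n
    simp only [LinearMap.compr₂ₛₗ_apply, TensorProduct.mk_apply, LinearMap.comp_apply,
      TensorProduct.map_tmul, hm.compR_eq]
    split_ifs with h
    · subst h
      rw [IsBi.unstrip_tmul (y := e) _ (by simpa [hn.strip_self] using hn)]
      simp [hm.strip_mul_of, hn.strip_self]
    · simp
  -- The summands are the projections onto these pieces; two of the three projections involved are
  -- absorbed by the coinvariance of `X` and the matching of degrees.
  have h1 : (comul (X : M) : M ⊗[k] M) =
      ∑ e, TensorProduct.map (H.compR e) (H.compL e ∘ₗ H.compR 1) (comul (X : M)) := by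
    have h2 : ∀ e, TensorProduct.map (H.compR e) (H.compL e ∘ₗ H.compR 1) (comul (X : M)) =
        (H.compL e).lTensor M (comul (X : M)) := by
      intro e
      have h3 : TensorProduct.map (H.compR e) (H.compL e ∘ₗ H.compR 1) =
          (H.compR e).rTensor M ∘ₗ (H.compL e).lTensor M ∘ₗ (H.compR 1).lTensor M := by
        rw [← LinearMap.lTensor_comp, LinearMap.rTensor_comp_lTensor]
      rw [h3, LinearMap.comp_apply, LinearMap.comp_apply, ← H.comul_compR,
        H.mem_coinv.1 X.2, H.lTensor_compL_comul, ← LinearMap.rTensor_comp_apply]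
      congr 2
      ext m
      simp [H.compR_compR]
    simp only [h2]
    generalize (comul (X : M) : M ⊗[k] M) = t
    induction t using TensorProduct.induction_on with
    | zero => simp
    | tmul x y => simp [← TensorProduct.tmul_sum, H.sum_compL]
    | add x y hx hy => simp only [map_add, Finset.sum_add_distrib, ← hx, ← hy]
  have h4 : H.unstrip (H.coinvComul X) =
      (H.unstrip ∘ₗ TensorProduct.map H.toCoinv H.toCoinv) (comul (X : M)) := rfl
  rw [h4, h1, map_sum]
  exact Finset.sum_congr rfl fun e _ => LinearMap.congr_fun (key e) (comul (X : M))

end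
end GradedPointedMajidAlgebra
end Majid

/-! ### Equivariance of the structure maps, associativity and coassociativity -/

section Majid
open Coalgebra
namespace GradedPointedMajidAlgebra

section
variable {k M G : Type*} [Field k] [NonAssocRing M] [Module k M]
    [IsScalarTower k M M] [SMulCommClass k M M] [Coalgebra k M] [CommGroup G]
    [Fintype G] [DecidableEq G]
    {H : GradedPointedMajidAlgebra k M G} {N : Type*} [AddCommGroup N] [Module k N]

/-- Moving `f` from the right end past `y` and then past `X` takes three reassociations, whose
scalars multiply to `Φ̃_f(x, y)⁻¹`. This is the first leg of `unstrip_act`. -/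
theorem IsBi.act_mul_of_mul_of {x : G} {X : H.coinv} (hX : H.IsBi x 1 (X : M)) (y f : G) :
    (H.cocycle.tw f x y : k) • (((H.coinvYD.act f X : M) * H.of y) * H.of f) =
      H.of f * ((X : M) * H.of y) := by
  rw [(hX.act f).assoc_eq (H.isBi_of y) (H.isBi_of f), ← H.of_mul, mul_comm y f, H.of_mul,
    (hX.act f).assoc_symm_eq (H.isBi_of f) (H.isBi_of y), hX.act_mul_of,
    (H.isBi_of f).assoc_eq hX (H.isBi_of y), smul_smul, smul_smul, smul_smul, ← Units.val_mul,
    ← Units.val_mul, ← Units.val_mul]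
  conv_rhs => rw [← one_smul k (H.of f * _), ← Units.val_one]
  congr 2
  simp only [ThreeCocycle.one_left, ThreeCocycle.normalized, ThreeCocycle.tw]
  apply Additive.ofMul.injective
  simp only [ofMul_mul, ofMul_div, ofMul_one]
  abel

/-- After multiplication by `f`, the relation `(f ▷ X) · f = f · X` moves `f` past `Y` and then past
`X`; the three associators cancel the scalar of the diagonal action. -/
theorem IsBi.act_mul {x y : G} {X Y : H.coinv} (hX : H.IsBi x 1 (X : M))
    (hY : H.IsBi y 1 (Y : M)) (f : G) :
    (H.cocycle.tw f x y : k) • ((H.coinvYD.act f X : M) * (H.coinvYD.act f Y : M)) =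
      H.strip (H.of f * ((X : M) * Y)) := by
  have hXY : H.IsBi (x * y) 1 ((X : M) * Y) := by simpa using hX.mul hY
  have hXY' : H.IsBi (x * y) 1 ((H.coinvYD.act f X : M) * (H.coinvYD.act f Y : M)) := by
    simpa using (hX.act f).mul (hY.act f)
  refine (hXY'.smul _).mul_of_cancel (h := f) (hXY.strip_of_mul f) ?_
  rw [(hXY.of_mul f).strip_mul_of, smul_mul_assoc, (hX.act f).assoc_eq (hY.act f) (H.isBi_of f),
    hY.act_mul_of, (hX.act f).assoc_symm_eq (H.isBi_of f) hY, hX.act_mul_of,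
    (H.isBi_of f).assoc_eq hX hY, smul_smul, smul_smul, smul_smul, ← Units.val_mul,
    ← Units.val_mul, ← Units.val_mul]
  conv_rhs => rw [← one_smul k (H.of f * _), ← Units.val_one]
  congr 2
  simp only [ThreeCocycle.one_right, ThreeCocycle.normalized, ThreeCocycle.tw]
  apply Additive.ofMul.injective
  simp only [ofMul_mul, ofMul_div, ofMul_one]
  abel

variable (H)

theorem isMor_coinvMul : YDModule.IsMor (H.coinvYD.tensor H.coinvYD) H.coinvYD H.coinvMul := by
  refine YDModule.isMor_tensor (fun e f X Y hX hY => ?_) (fun g e f X Y hX hY => ?_)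
  · rw [coinvYD_isHom] at hX hY ⊢
    simpa using hX.mul hY
  · rw [coinvYD_isHom] at hX hY
    apply Subtype.ext
    rw [map_smul, Submodule.coe_smul, coe_coinvMul_tmul, hX.act_mul hY, coe_coinvYD_act,
      coe_coinvMul_tmul]

theorem isMor_coinvOne : YDModule.IsMor (YDModule.unit H.cocycle) H.coinvYD H.coinvOne := by
  constructor
  · intro g a
    apply Subtype.ext
    change ((H.coinvOne (((if g = 1 then LinearMap.id else 0) : k →ₗ[k] k) a) : H.coinv) : M) =
      H.compL g (a • (1 : M))
    rw [map_smul, H.isBi_one.compL_eq]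
    split_ifs <;> simp
  · intro f a
    apply Subtype.ext
    have h1 : H.strip (H.of f * 1) = 1 := by
      have := H.isBi_one.strip_mul f
      rwa [one_mul, ← mul_one (H.of f)] at this
    change a • (1 : M) = H.strip (H.of f * (a • (1 : M)))
    rw [mul_smul_comm, map_smul, h1]

theorem isMor_coinvCounit :
    YDModule.IsMor H.coinvYD (YDModule.unit H.cocycle) H.coinvCounit := by
  refine YDModule.isMor_of_isHom (fun g X hX => ?_) (fun f g X hX => ?_)
  · rw [coinvYD_isHom] at hX
    by_cases hg : g = 1
    · subst hg
      exact YDModule.unit_isHom _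
    · rw [coinvCounit_apply, hX.counit_eq_zero hg]
      simp [YDModule.IsHom]
  · rw [coinvYD_isHom] at hX
    have h := congrArg (counit (R := k)) (hX.act_mul_of f)
    rw [H.counit_mul_eq, H.counit_mul_eq, H.counit_of, one_mul, mul_one] at h
    exact h

theorem unstrip_proj (g : G) (t : H.coinv ⊗[k] H.coinv) :
    H.unstrip ((H.coinvYD.tensor H.coinvYD).proj g t) = (H.compL g).rTensor M (H.unstrip t) := by
  refine LinearMap.congr_fun (f := H.unstrip ∘ₗ (H.coinvYD.tensorProj H.coinvYD g))
    (g := (H.compL g).rTensor M ∘ₗ H.unstrip) (H.coinv_tmul_ext fun x y X Y hX hY => ?_) t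
  rw [LinearMap.comp_apply, LinearMap.comp_apply, YDModule.tensorProj_tmul
    (H.coinvYD_isHom.2 hX) (H.coinvYD_isHom.2 hY), hY.unstrip_tmul, LinearMap.rTensor_tmul,
    (hX.mul (H.isBi_of y)).compL_eq]
  split_ifs <;> simp [hY.unstrip_tmul]

/-- The analogue for `R ⊗ R` of `(f ▷ X) · f = f · X`. The scalar of the diagonal action is used up
entirely in the first leg. -/
theorem unstrip_act (f : G) (t : H.coinv ⊗[k] H.coinv) :
    H.unstrip ((H.coinvYD.tensor H.coinvYD).act f t) * (H.of f ⊗ₜ H.of f) =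
      (H.of f ⊗ₜ H.of f) * H.unstrip t := by
  refine LinearMap.congr_fun
    (f := LinearMap.mulRight k (H.of f ⊗ₜ H.of f) ∘ₗ H.unstrip ∘ₗ
      (H.coinvYD.tensorAct H.coinvYD f))
    (g := LinearMap.mulLeft k (H.of f ⊗ₜ H.of f) ∘ₗ H.unstrip)
    (H.coinv_tmul_ext fun x y X Y hX hY => ?_) t
  simp only [LinearMap.comp_apply, LinearMap.mulRight_apply, LinearMap.mulLeft_apply]
  rw [YDModule.tensorAct_tmul (H.coinvYD_isHom.2 hX) (H.coinvYD_isHom.2 hY), map_smul,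
    (hY.act f).unstrip_tmul, hY.unstrip_tmul, smul_mul_assoc,
    Algebra.TensorProduct.tmul_mul_tmul, Algebra.TensorProduct.tmul_mul_tmul, hY.act_mul_of,
    TensorProduct.smul_tmul', hX.act_mul_of_mul_of]

/-- Equivariance is the comultiplication of `M` applied to `(f ▷ X) · f = f · X`, compared through
`unstrip` after multiplication by `f ⊗ f`. -/
theorem isMor_coinvComul :
    YDModule.IsMor H.coinvYD (H.coinvYD.tensor H.coinvYD) H.coinvComul := by
  refine YDModule.isMor_of_isHom (fun g X hX => ?_) (fun f g X hX => ?_)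
  · rw [coinvYD_isHom] at hX
    apply H.unstrip_injective
    rw [H.unstrip_proj, H.unstrip_coinvComul, ← H.comul_compL, hX.left]
  · rw [coinvYD_isHom] at hX
    apply H.unstrip_injective
    apply H.mul_of_tmul_of_injective f
    dsimp only
    rw [H.unstrip_act, H.unstrip_coinvComul, H.unstrip_coinvComul, ← H.comul_of,
      ← H.comul_mul_eq, ← H.comul_mul_eq, hX.act_mul_of]

theorem coinvMul_assoc :
    H.coinvMul ∘ₗ TensorProduct.map H.coinvMul LinearMap.id =
      H.coinvMul ∘ₗ TensorProduct.map LinearMap.id H.coinvMul ∘ₗ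
        YDModule.assocHom H.coinvYD H.coinvYD H.coinvYD := by
  refine H.coinvYD.ext_tmul₃ H.coinvYD H.coinvYD fun x y z X Y Z hX hY hZ => ?_
  simp only [LinearMap.comp_apply, YDModule.assocHom_tmul hX hY hZ]
  rw [coinvYD_isHom] at hX hY hZ
  apply Subtype.ext
  simp only [map_smul, Submodule.coe_smul, TensorProduct.map_tmul, LinearMap.id_apply,
    coe_coinvMul_tmul]
  rw [hX.assoc_eq hY hZ, ThreeCocycle.one_left, one_div]

theorem lid_rTensor_counit_unstrip (t : H.coinv ⊗[k] H.coinv) :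
    TensorProduct.lid k M ((counit (R := k)).rTensor M (H.unstrip t)) =
      TensorProduct.lid k H.coinv (H.coinvCounit.rTensor H.coinv t) := by
  refine LinearMap.congr_fun
    (f := (TensorProduct.lid k M).toLinearMap ∘ₗ (counit (R := k)).rTensor M ∘ₗ H.unstrip)
    (g := H.coinv.subtype ∘ₗ (TensorProduct.lid k H.coinv).toLinearMap ∘ₗ
      H.coinvCounit.rTensor H.coinv)
    (H.coinv_tmul_ext fun x y X Y hX hY => ?_) t
  simp [hY.unstrip_tmul, H.counit_mul_eq, H.counit_of]

theorem rid_lTensor_counit_unstrip (t : H.coinv ⊗[k] H.coinv) :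
    TensorProduct.rid k M ((counit (R := k)).lTensor M (H.unstrip t)) =
      TensorProduct.rid k H.coinv (H.coinvCounit.lTensor H.coinv t) := by
  refine LinearMap.congr_fun
    (f := (TensorProduct.rid k M).toLinearMap ∘ₗ (counit (R := k)).lTensor M ∘ₗ H.unstrip)
    (g := H.coinv.subtype ∘ₗ (TensorProduct.rid k H.coinv).toLinearMap ∘ₗ
      H.coinvCounit.lTensor H.coinv)
    (H.coinv_tmul_ext fun x y X Y hX hY => ?_) t
  by_cases hy : y = 1
  · subst hy
    simp [hY.unstrip_tmul, H.of_one]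
  · simp [hY.unstrip_tmul, hY.counit_eq_zero hy]

theorem lid_rTensor_coinvCounit (X : H.coinv) :
    TensorProduct.lid k H.coinv (H.coinvCounit.rTensor H.coinv (H.coinvComul X)) = X := by
  apply Subtype.ext
  rw [← H.lid_rTensor_counit_unstrip, H.unstrip_coinvComul, rTensor_counit_comul]
  simp

theorem rid_lTensor_coinvCounit (X : H.coinv) :
    TensorProduct.rid k H.coinv (H.coinvCounit.lTensor H.coinv (H.coinvComul X)) = X := by
  apply Subtype.ext
  rw [← H.rid_lTensor_counit_unstrip, H.unstrip_coinvComul, lTensor_counit_comul]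
  simp

/-- The embedding `X ⊗ (Y ⊗ Z) ↦ X · yz ⊗ (Y · z ⊗ Z)` for `Y`, `Z` of degrees `y`, `z`. -/
noncomputable def unstrip₃ : H.coinv ⊗[k] (H.coinv ⊗[k] H.coinv) →ₗ[k] M ⊗[k] (M ⊗[k] M) :=
  ∑ g, TensorProduct.map (LinearMap.mulRight k (H.of g) ∘ₗ H.coinv.subtype)
    (H.unstrip ∘ₗ (H.coinvYD.tensor H.coinvYD).proj g)

theorem unstrip₃_tmul (X : H.coinv) {t : H.coinv ⊗[k] H.coinv} {g : G}
    (ht : (H.coinvYD.tensor H.coinvYD).IsHom g t) :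
    H.unstrip₃ (X ⊗ₜ t) = ((X : M) * H.of g) ⊗ₜ H.unstrip t := by
  simp only [unstrip₃, LinearMap.sum_apply, TensorProduct.map_tmul, LinearMap.comp_apply,
    Submodule.subtype_apply, ht.proj_eq, LinearMap.mulRight_apply]
  rw [Finset.sum_eq_single g (fun b _ hb => by simp [hb]) (by simp)]
  simp

theorem unstrip₃_injective : Function.Injective H.unstrip₃ := by
  refine Function.LeftInverse.injective
    (g := TensorProduct.map H.toCoinv (TensorProduct.map H.toCoinv H.toCoinv)) fun t => ?_
  refine LinearMap.congr_fun
    (f := TensorProduct.map H.toCoinv (TensorProduct.map H.toCoinv H.toCoinv) ∘ₗ H.unstrip₃)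
    (g := LinearMap.id) (H.coinvYD.ext_tmul₃' H.coinvYD H.coinvYD
      fun x y z X Y Z hX hY hZ => ?_) t
  rw [LinearMap.comp_apply, H.unstrip₃_tmul _ (hY.tmul hZ), TensorProduct.map_tmul,
    H.toCoinv_unstrip, LinearMap.id_apply]
  congr 1
  exact Subtype.ext ((H.coinvYD_isHom.1 hX).strip_mul _)

/-- The associativity constraint of the category is precisely the scalar in `(X · y) · z = Φ(x, y,
z)⁻¹ X · (yz)`. -/
theorem unstrip₃_assocHom_tmul (t : H.coinv ⊗[k] H.coinv) {z : G} {Z : H.coinv}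
    (hZ : H.IsBi z 1 (Z : M)) :
    H.unstrip₃ (YDModule.assocHom H.coinvYD H.coinvYD H.coinvYD (t ⊗ₜ Z)) =
      TensorProduct.assoc k M M M ((H.unstrip t * (H.of z ⊗ₜ H.of z)) ⊗ₜ (Z : M)) := by
  refine LinearMap.congr_fun
    (f := H.unstrip₃ ∘ₗ YDModule.assocHom H.coinvYD H.coinvYD H.coinvYD ∘ₗ
      (TensorProduct.mk k _ _).flip Z)
    (g := (TensorProduct.assoc k M M M).toLinearMap ∘ₗ (TensorProduct.mk k _ _).flip (Z : M) ∘ₗ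
      LinearMap.mulRight k (H.of z ⊗ₜ H.of z) ∘ₗ H.unstrip)
    (H.coinv_tmul_ext fun x y X Y hX hY => ?_) t
  have hX' := H.coinvYD_isHom.2 hX
  have hY' := H.coinvYD_isHom.2 hY
  have hZ' := H.coinvYD_isHom.2 hZ
  simp only [LinearMap.comp_apply, LinearMap.flip_apply, TensorProduct.mk_apply,
    YDModule.assocHom_tmul hX' hY' hZ', map_smul, H.unstrip₃_tmul _ (hY'.tmul hZ'),
    hZ.unstrip_tmul, hY.unstrip_tmul, LinearMap.mulRight_apply,
    Algebra.TensorProduct.tmul_mul_tmul, LinearEquiv.coe_coe, TensorProduct.assoc_tmul]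
  rw [hX.assoc_eq (H.isBi_of y) (H.isBi_of z), ← H.of_mul, ThreeCocycle.one_left, one_div,
    TensorProduct.smul_tmul']

theorem coinvComul_coassoc :
    TensorProduct.map LinearMap.id H.coinvComul ∘ₗ H.coinvComul =
      YDModule.assocHom H.coinvYD H.coinvYD H.coinvYD ∘ₗ
        TensorProduct.map H.coinvComul LinearMap.id ∘ₗ H.coinvComul := by
  have h1 : H.unstrip₃ ∘ₗ TensorProduct.map LinearMap.id H.coinvComul =
      comul.lTensor M ∘ₗ H.unstrip := by
    refine H.coinv_tmul_ext fun x y X Y hX hY => ?_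
    simp only [LinearMap.comp_apply, TensorProduct.map_tmul, LinearMap.id_apply]
    rw [H.unstrip₃_tmul _ (H.isMor_coinvComul.isHom (H.coinvYD_isHom.2 hY)),
      H.unstrip_coinvComul, hY.unstrip_tmul, LinearMap.lTensor_tmul]
  -- The extra factor `z ⊗ z` of the preceding lemma is what `Δ(X · z) = Δ(X)(z ⊗ z)` supplies.
  have h2 : H.unstrip₃ ∘ₗ YDModule.assocHom H.coinvYD H.coinvYD H.coinvYD ∘ₗ
      TensorProduct.map H.coinvComul LinearMap.id =
      (TensorProduct.assoc k M M M).toLinearMap ∘ₗ comul.rTensor M ∘ₗ H.unstrip := by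
    refine H.coinv_tmul_ext fun x y X Y hX hY => ?_
    simp only [LinearMap.comp_apply, TensorProduct.map_tmul, LinearMap.id_apply]
    rw [H.unstrip₃_assocHom_tmul _ hY, H.unstrip_coinvComul, hY.unstrip_tmul,
      LinearMap.rTensor_tmul, H.comul_mul_eq, H.comul_of]
    rfl
  ext X : 1
  apply H.unstrip₃_injective
  have e1 := LinearMap.congr_fun h1 (H.coinvComul X)
  have e2 := LinearMap.congr_fun h2 (H.coinvComul X)
  simp only [LinearMap.comp_apply, H.unstrip_coinvComul, LinearEquiv.coe_coe,
    coassoc_apply] at e1 e2 ⊢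
  rw [e1, e2]

theorem coinvComul_one : H.coinvComul (H.coinvOne 1) = H.coinvOne 1 ⊗ₜ H.coinvOne 1 := by
  apply H.unstrip_injective
  have h1 : H.IsBi 1 1 (H.coinvOne 1 : M) := by simpa using H.isBi_one
  rw [H.unstrip_coinvComul, h1.unstrip_tmul, coe_coinvOne, one_smul, H.of_one, mul_one,
    H.one_groupLike.comul_eq_tmul_self]

/-- The product of `M` in the form `R · G`: `b` is moved past `C` at the cost of the action. The raw
product of associators is brought to this shape by the cocycle condition at `(a, b, c, d)` and `(a,
c, b, d)`. -/
theorem IsBi.mul_of_mul_mul_of {H : GradedPointedMajidAlgebra k M G} {a c : G} {A C : H.coinv}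
    (hA : H.IsBi a 1 (A : M)) (hC : H.IsBi c 1 (C : M)) (b d : G) :
    ((A : M) * H.of b) * ((C : M) * H.of d) =
      ((H.cocycle a c (b * d) * (H.cocycle c b d)⁻¹ * H.cocycle b c d *
        (H.cocycle a b (c * d))⁻¹ : kˣ) : k) •
        (((A : M) * (H.coinvYD.act b C : M)) * H.of (b * d)) := by
  have hAb := hA.mul (H.isBi_of b)
  have hC' := hC.act b
  have hAC : H.IsBi (a * c) 1 ((A : M) * (H.coinvYD.act b C : M)) := by simpa using hA.mul hC'
  rw [hAb.assoc_symm_eq hC (H.isBi_of d), hA.assoc_eq (H.isBi_of b) hC, ← hC.act_mul_of,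
    hA.assoc_symm_eq hC' (H.isBi_of b), smul_smul, smul_mul_assoc, smul_smul,
    hAC.assoc_eq (H.isBi_of b) (H.isBi_of d), smul_smul, ← H.of_mul, ← Units.val_mul,
    ← Units.val_mul, ← Units.val_mul]
  congr 2
  have h1 := congrArg Additive.ofMul (H.cocycle.cocycle a b c d)
  have h2 := congrArg Additive.ofMul (H.cocycle.cocycle a c b d)
  rw [mul_comm c b] at h2
  simp only [ThreeCocycle.one_left, ThreeCocycle.one_right, ThreeCocycle.normalized, one_mul]
  apply Additive.ofMul.injective
  simp only [ofMul_mul, ofMul_div, ofMul_one, ofMul_inv] at h1 h2 ⊢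
  linear_combination (norm := abel) h1 - h2

end
end GradedPointedMajidAlgebra
end Majid

/-! ### Multiplicativity of the comultiplication -/

section Majid
open Coalgebra
namespace GradedPointedMajidAlgebra

section
variable {k M G : Type*} [Field k] [NonAssocRing M] [Module k M]
    [IsScalarTower k M M] [SMulCommClass k M M] [Coalgebra k M] [CommGroup G]
    [Fintype G] [DecidableEq G]
    (H : GradedPointedMajidAlgebra k M G)

/-- The middle-four interchange `(A ⊗ B) ⊗ (C ⊗ D) → (A ⊗ C) ⊗ (B ⊗ D)` on `R`. -/
noncomputable def coinvTensorμ :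
    (H.coinv ⊗[k] H.coinv) ⊗[k] (H.coinv ⊗[k] H.coinv) →ₗ[k]
      (H.coinv ⊗[k] H.coinv) ⊗[k] (H.coinv ⊗[k] H.coinv) :=
  -- The constraints are composed in the order of the categorical `tensorμ`, so that the bialgebra
  -- axiom unfolds to a statement about this map.
  YDModule.assocInv H.coinvYD H.coinvYD (H.coinvYD.tensor H.coinvYD) ∘ₗ
    TensorProduct.map LinearMap.id (YDModule.assocHom H.coinvYD H.coinvYD H.coinvYD) ∘ₗ
    TensorProduct.map LinearMap.id
      (TensorProduct.map (YDModule.braidHom H.coinvYD H.coinvYD) LinearMap.id) ∘ₗ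
    TensorProduct.map LinearMap.id (YDModule.assocInv H.coinvYD H.coinvYD H.coinvYD) ∘ₗ
    YDModule.assocHom H.coinvYD H.coinvYD (H.coinvYD.tensor H.coinvYD)

/-- The second legs multiply without any scalar. In the first legs, the scalar of
`IsBi.mul_of_mul_mul_of` is exactly the product of the four associativity constraints in the
interchange. -/
theorem unstrip_coinvMul_tensorμ (s t : H.coinv ⊗[k] H.coinv) :
    H.unstrip (TensorProduct.map H.coinvMul H.coinvMul (H.coinvTensorμ (s ⊗ₜ t))) =
      H.unstrip s * H.unstrip t := by
  have key : (TensorProduct.mk k _ _).compr₂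
        (H.unstrip ∘ₗ TensorProduct.map H.coinvMul H.coinvMul ∘ₗ H.coinvTensorμ) =
      (LinearMap.mul k (M ⊗[k] M)).compl₁₂ H.unstrip H.unstrip := by
    refine H.coinv_tmul_ext fun a b A B hA hB => H.coinv_tmul_ext fun c d C D hC hD => ?_
    have hA' := H.coinvYD_isHom.2 hA
    have hB' := H.coinvYD_isHom.2 hB
    have hC' := H.coinvYD_isHom.2 hC
    have hD' := H.coinvYD_isHom.2 hD
    have hBD : H.IsBi (b * d) 1 (H.coinvMul (B ⊗ₜ D) : M) := by
      simpa using hB.mul hD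
    simp only [LinearMap.compr₂_apply, TensorProduct.mk_apply, LinearMap.compl₁₂_apply,
      LinearMap.mul_apply', coinvTensorμ, LinearMap.comp_apply,
      YDModule.assocHom_tmul hA' hB' (hC'.tmul hD'), map_smul, TensorProduct.map_tmul,
      YDModule.assocInv_tmul hB' hC' hD', TensorProduct.tmul_smul, LinearMap.id_apply,
      YDModule.braidHom_tmul hB', YDModule.assocHom_tmul (hC'.act b) hB' hD',
      YDModule.assocInv_tmul hA' (hC'.act b) (hB'.tmul hD'), hBD.unstrip_tmul,
      hB.unstrip_tmul, hD.unstrip_tmul, Algebra.TensorProduct.tmul_mul_tmul,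
      coe_coinvMul_tmul, smul_smul, ← Units.val_mul]
    rw [hA.mul_of_mul_mul_of hC, TensorProduct.smul_tmul']
    congr 2
    refine congrArg Units.val ?_
    apply Additive.ofMul.injective
    simp only [ofMul_mul, ofMul_inv]
    abel
  exact LinearMap.congr_fun₂ key s t

theorem coinvComul_mul :
    H.coinvComul ∘ₗ H.coinvMul = TensorProduct.map H.coinvMul H.coinvMul ∘ₗ H.coinvTensorμ ∘ₗ
      TensorProduct.map H.coinvComul H.coinvComul := by
  apply TensorProduct.ext'
  intro X Y
  apply H.unstrip_injective
  simp only [LinearMap.comp_apply, TensorProduct.map_tmul]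
  rw [H.unstrip_coinvMul_tensorμ, H.unstrip_coinvComul, H.unstrip_coinvComul,
    H.unstrip_coinvComul, coe_coinvMul_tmul, H.comul_mul_eq]

/-! ### The antipode -/

variable {H} in
-- `S(X)` has bidegree `(1, x⁻¹)`, and the factor `x` brings it back into `R`, in degree `x`.
theorem IsBi.of_mul_S {x : G} {X : M} (hX : H.IsBi x 1 X) : H.IsBi x 1 (H.of x * H.S X) := by
  simpa using (H.isBi_of x).mul hX.S

/-- The antipode of `R`. -/
noncomputable def coinvAntipode : H.coinv →ₗ[k] H.coinv :=
  (∑ x, (((H.cocycle x x⁻¹ x)⁻¹ : kˣ) : k) •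
    (LinearMap.mulLeft k (H.of x) ∘ₗ H.S ∘ₗ H.compL x ∘ₗ H.coinv.subtype)).codRestrict _ <| by
    intro X
    rw [LinearMap.sum_apply]
    exact Submodule.sum_mem _ fun x _ => H.coinv.smul_mem _
      (H.isBi_compL_coinv x X).of_mul_S.mem_coinv

variable {H}

theorem IsBi.coe_coinvAntipode {x : G} {X : H.coinv} (hX : H.IsBi x 1 (X : M)) :
    (H.coinvAntipode X : M) = (((H.cocycle x x⁻¹ x)⁻¹ : kˣ) : k) • (H.of x * H.S (X : M)) := by
  simp only [coinvAntipode, LinearMap.codRestrict_apply, LinearMap.sum_apply,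
    LinearMap.smul_apply, LinearMap.comp_apply, Submodule.subtype_apply,
    LinearMap.mulLeft_apply, hX.compL_eq]
  rw [Finset.sum_eq_single x (fun b _ hb => by simp [hb]) (by simp), if_pos rfl]

theorem IsBi.coinvAntipode {x : G} {X : H.coinv} (hX : H.IsBi x 1 (X : M)) :
    H.IsBi x 1 (H.coinvAntipode X : M) := by
  rw [hX.coe_coinvAntipode]
  exact hX.of_mul_S.smul _

variable (H)

/-- The convolution of linear endomorphisms of `R`. -/
noncomputable def coinvConv (a b : H.coinv →ₗ[k] H.coinv) : H.coinv →ₗ[k] H.coinv :=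
  H.coinvMul ∘ₗ TensorProduct.map a b ∘ₗ H.coinvComul

/-- The space of grading preserving endomorphisms of `R`. -/
def gradedEnd : Submodule k (H.coinv →ₗ[k] H.coinv) where
  carrier := {a | ∀ g X, a (H.coinvYD.proj g X) = H.coinvYD.proj g (a X)}
  add_mem' ha hb g X := by simp [ha g X, hb g X]
  zero_mem' g X := by simp
  smul_mem' c a ha g X := by simp [ha g X]

variable {H}

theorem isHom_of_mem_gradedEnd {a : H.coinv →ₗ[k] H.coinv} (ha : a ∈ H.gradedEnd) {g : G}
    {X : H.coinv} (hX : H.coinvYD.IsHom g X) : H.coinvYD.IsHom g (a X) := by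
  rw [YDModule.IsHom, ← ha g X, show H.coinvYD.proj g X = X from hX]

theorem mem_gradedEnd {a : H.coinv →ₗ[k] H.coinv}
    (ha : ∀ g X, H.coinvYD.IsHom g X → H.coinvYD.IsHom g (a X)) : a ∈ H.gradedEnd := by
  intro g X
  refine LinearMap.congr_fun (f := a ∘ₗ H.coinvYD.proj g) (g := H.coinvYD.proj g ∘ₗ a)
    (H.coinvYD.ext_isHom fun e X hX => ?_) X
  rw [LinearMap.comp_apply, LinearMap.comp_apply, hX.proj_eq, (ha e X hX).proj_eq]
  split_ifs <;> simp

theorem coinvConv_mem {a b : H.coinv →ₗ[k] H.coinv} (ha : a ∈ H.gradedEnd)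
    (hb : b ∈ H.gradedEnd) : H.coinvConv a b ∈ H.gradedEnd := by
  refine mem_gradedEnd fun g X hX => ?_
  have h1 := H.isMor_coinvComul.isHom hX
  refine H.isMor_coinvMul.isHom ?_
  have h2 : TensorProduct.map a b ∘ₗ H.coinvYD.tensorProj H.coinvYD g =
      H.coinvYD.tensorProj H.coinvYD g ∘ₗ TensorProduct.map a b := by
    refine H.coinvYD.ext_tmul H.coinvYD fun x y X Y hX hY => ?_
    rw [LinearMap.comp_apply, LinearMap.comp_apply, YDModule.tensorProj_tmul hX hY,
      TensorProduct.map_tmul, YDModule.tensorProj_tmul (isHom_of_mem_gradedEnd ha hX)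
        (isHom_of_mem_gradedEnd hb hY)]
    split_ifs <;> simp
  have h3 := LinearMap.congr_fun h2 (H.coinvComul X)
  rw [LinearMap.comp_apply, LinearMap.comp_apply, show H.coinvYD.tensorProj H.coinvYD g
    (H.coinvComul X) = H.coinvComul X from h1] at h3
  exact h3.symm

/-- The associativity constraint depends only on degrees, so it commutes with `a ⊗ b ⊗ c` for graded
maps. Equivariance is not required, and for the antipode it will only be a consequence of this
algebra. -/
theorem coinvConv_assoc {a b c : H.coinv →ₗ[k] H.coinv} (ha : a ∈ H.gradedEnd)
    (hb : b ∈ H.gradedEnd) (hc : c ∈ H.gradedEnd) :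
    H.coinvConv (H.coinvConv a b) c = H.coinvConv a (H.coinvConv b c) := by
  have h1 : YDModule.assocHom H.coinvYD H.coinvYD H.coinvYD ∘ₗ
      TensorProduct.map (TensorProduct.map a b) c = TensorProduct.map a (TensorProduct.map b c) ∘ₗ
        YDModule.assocHom H.coinvYD H.coinvYD H.coinvYD := by
    refine H.coinvYD.ext_tmul₃ H.coinvYD H.coinvYD fun x y z X Y Z hX hY hZ => ?_
    simp only [LinearMap.comp_apply, TensorProduct.map_tmul, YDModule.assocHom_tmul hX hY hZ,
      YDModule.assocHom_tmul (isHom_of_mem_gradedEnd ha hX) (isHom_of_mem_gradedEnd hb hY)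
        (isHom_of_mem_gradedEnd hc hZ), map_smul]
  have h2 : TensorProduct.map (H.coinvConv a b) c =
      TensorProduct.map H.coinvMul LinearMap.id ∘ₗ TensorProduct.map (TensorProduct.map a b) c ∘ₗ
        TensorProduct.map H.coinvComul LinearMap.id := by
    rw [← TensorProduct.map_comp, ← TensorProduct.map_comp]
    rfl
  have h3 : TensorProduct.map a (H.coinvConv b c) =
      TensorProduct.map LinearMap.id H.coinvMul ∘ₗ TensorProduct.map a (TensorProduct.map b c) ∘ₗ
        TensorProduct.map LinearMap.id H.coinvComul := by
    rw [← TensorProduct.map_comp, ← TensorProduct.map_comp]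
    rfl
  ext X : 1
  have e1 := fun t => LinearMap.congr_fun h1 t
  have e2 := fun t => LinearMap.congr_fun H.coinvMul_assoc t
  have e3 := LinearMap.congr_fun H.coinvComul_coassoc X
  simp only [LinearMap.comp_apply] at e1 e2 e3
  change H.coinvMul (TensorProduct.map (H.coinvConv a b) c (H.coinvComul X)) =
    H.coinvMul (TensorProduct.map a (H.coinvConv b c) (H.coinvComul X))
  rw [h2, h3]
  simp only [LinearMap.comp_apply]
  rw [e2, e1, e3]

variable (H)

theorem unit_coinvConv (a : H.coinv →ₗ[k] H.coinv) :
    H.coinvConv (H.coinvOne ∘ₗ H.coinvCounit) a = a := by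
  ext X : 1
  have h : ∀ t, H.coinvMul (TensorProduct.map (H.coinvOne ∘ₗ H.coinvCounit) a t) =
      a (TensorProduct.lid k H.coinv (H.coinvCounit.rTensor H.coinv t)) := by
    intro t
    induction t using TensorProduct.induction_on with
    | zero => simp
    | tmul A B =>
      apply Subtype.ext
      simp
    | add x y hx hy => simp only [map_add, hx, hy]
  exact (h _).trans (by rw [H.lid_rTensor_coinvCounit])

theorem coinvConv_unit (a : H.coinv →ₗ[k] H.coinv) :
    H.coinvConv a (H.coinvOne ∘ₗ H.coinvCounit) = a := by
  ext X : 1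
  have h : ∀ t, H.coinvMul (TensorProduct.map a (H.coinvOne ∘ₗ H.coinvCounit) t) =
      a (TensorProduct.rid k H.coinv (H.coinvCounit.lTensor H.coinv t)) := by
    intro t
    induction t using TensorProduct.induction_on with
    | zero => simp
    | tmul A B =>
      apply Subtype.ext
      simp
    | add x y hx hy => simp only [map_add, hx, hy]
  exact (h _).trans (by rw [H.rid_lTensor_coinvCounit])

theorem isMor_unit : YDModule.IsMor H.coinvYD H.coinvYD (H.coinvOne ∘ₗ H.coinvCounit) where
  map_proj g X := by
    rw [LinearMap.comp_apply, H.isMor_coinvCounit.map_proj, H.isMor_coinvOne.map_proj]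
    rfl
  map_act f X := by
    rw [LinearMap.comp_apply, H.isMor_coinvCounit.map_act, H.isMor_coinvOne.map_act]
    rfl

variable {H} in
theorem IsBi.β_eq {x : G} {X : M} (hX : H.IsBi x 1 X) : H.β X = counit (R := k) X := by
  rw [H.β_eq]
  simp only [LinearMap.sum_apply, LinearMap.smul_apply, hX.coef_eq_right]
  rw [Finset.sum_eq_single 1 (fun b _ hb => by simp [hb]) (by simp)]
  simp [ThreeCocycle.one_left]

variable {H} in
theorem IsBi.convL_β {x y : G} {X : M} (hX : H.IsBi x y X) :
    convL H.β LinearMap.id X = (((H.cocycle x x⁻¹ x)⁻¹ : kˣ) : k) • X := by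
  have h : convL H.β (LinearMap.id : M →ₗ[k] M) X =
      ∑ g, (((H.cocycle g g⁻¹ g)⁻¹ : kˣ) : k) • H.compL g X := by
    rw [H.β_eq, convL_sum_left]
    simp only [convL_smul_left, LinearMap.sum_apply, LinearMap.smul_apply]
    rfl
  rw [h, Finset.sum_eq_single x (fun b _ hb => by simp [hX.compL_eq, hb]) (by simp), hX.left]

/-- This is `a₁ β(a₂) S(a₃) = β(a) 1` read through `unstrip`. On `R` the functional `β` is `ε`; on
the second leg, of left degree `y`, it contributes the scalar `Φ(y, y⁻¹, y)⁻¹` of the antipode. The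
reassociation `(X · y) · S(Y) = X · (y · S(Y))` is strict because `X` has right degree `1` and
`S(Y)` left degree `1`. -/
theorem id_coinvConv_antipode :
    H.coinvConv LinearMap.id H.coinvAntipode = H.coinvOne ∘ₗ H.coinvCounit := by
  have h1 : LinearMap.mul' k M ∘ₗ H.S.lTensor M ∘ₗ
      (convL H.β LinearMap.id).lTensor M ∘ₗ H.unstrip =
      H.coinv.subtype ∘ₗ H.coinvMul ∘ₗ TensorProduct.map LinearMap.id H.coinvAntipode := by
    refine H.coinv_tmul_ext fun x y X Y hX hY => ?_
    simp only [LinearMap.comp_apply, hY.unstrip_tmul, LinearMap.lTensor_tmul,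
      LinearMap.mul'_apply, TensorProduct.map_tmul, Submodule.subtype_apply, coe_coinvMul_tmul,
      LinearMap.id_apply, hY.convL_β, map_smul, hY.coe_coinvAntipode, mul_smul_comm]
    rw [hX.assoc_eq (H.isBi_of y) hY.S, ThreeCocycle.one_left, inv_one, ThreeCocycle.one_right]
    simp
  refine H.coinv_ext fun x X hX => Subtype.ext ?_
  have h2 := LinearMap.congr_fun h1 (H.coinvComul X)
  simp only [LinearMap.comp_apply, H.unstrip_coinvComul] at h2
  have h3 := H.β_S X
  rw [hX.β_eq] at h3
  exact h2.symm.trans h3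

theorem id_mem_gradedEnd : LinearMap.id ∈ H.gradedEnd := fun _ _ => rfl

theorem antipode_mem_gradedEnd : H.coinvAntipode ∈ H.gradedEnd :=
  mem_gradedEnd fun g X hX => by
    rw [coinvYD_isHom] at hX ⊢
    exact hX.coinvAntipode

/-- On each degree `f⁻¹ ▷ (f ▷ X)` is a nonzero multiple of `X`. -/
theorem coinvYD_act_injective (f : G) : Function.Injective (H.coinvYD.act f) := by
  rw [← LinearMap.ker_eq_bot, LinearMap.ker_eq_bot']
  intro X hX
  rw [← H.coinvYD.sum_proj X]
  refine Finset.sum_eq_zero fun g _ => ?_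
  have h := H.coinvYD.act_act f⁻¹ f g X
  rw [← H.coinvYD.proj_act, hX, map_zero, map_zero, inv_mul_cancel, H.coinvYD.act_one] at h
  exact (smul_eq_zero.1 h.symm).resolve_left (Units.ne_zero _)

variable [FiniteDimensional k M]

variable {H} in
/-- Convolution with the identity can be cancelled, as it is surjective on a finite-dimensional
space. -/
theorem id_coinvConv_cancel {a b : H.coinv →ₗ[k] H.coinv} (ha : a ∈ H.gradedEnd)
    (hb : b ∈ H.gradedEnd)
    (hab : H.coinvConv LinearMap.id a = H.coinvConv LinearMap.id b) : a = b := by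
  let L : H.gradedEnd →ₗ[k] H.gradedEnd :=
    { toFun := fun a => ⟨H.coinvConv LinearMap.id a, coinvConv_mem H.id_mem_gradedEnd a.2⟩
      map_add' := fun a b => Subtype.ext <| by
        simp [coinvConv, TensorProduct.map_add_right, LinearMap.add_comp, LinearMap.comp_add]
      map_smul' := fun c a => Subtype.ext <| by
        simp [coinvConv, TensorProduct.map_smul_right, LinearMap.smul_comp, LinearMap.comp_smul] }
  have hL : Function.Surjective L := by
    intro c
    -- A preimage of `c` is `S_R * c`, because `id * S_R` is the convolution unit.
    refine ⟨⟨H.coinvConv H.coinvAntipode c, coinvConv_mem H.antipode_mem_gradedEnd c.2⟩, ?_⟩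
    apply Subtype.ext
    change H.coinvConv LinearMap.id (H.coinvConv H.coinvAntipode c) = c
    rw [← coinvConv_assoc H.id_mem_gradedEnd H.antipode_mem_gradedEnd c.2,
      H.id_coinvConv_antipode, H.unit_coinvConv]
  have hL' : Function.Injective L :=
    (LinearMap.injective_iff_surjective (V := H.gradedEnd) (f := L)).2 hL
  exact congrArg Subtype.val (@hL' ⟨a, ha⟩ ⟨b, hb⟩ (Subtype.ext hab))

/-- Both sides become the identity after left convolution with the identity, so cancellation
applies. -/
theorem antipode_coinvConv_id :
    H.coinvConv H.coinvAntipode LinearMap.id = H.coinvOne ∘ₗ H.coinvCounit := by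
  refine id_coinvConv_cancel (coinvConv_mem H.antipode_mem_gradedEnd H.id_mem_gradedEnd)
    H.isMor_unit.map_proj ?_
  rw [← coinvConv_assoc H.id_mem_gradedEnd H.antipode_mem_gradedEnd H.id_mem_gradedEnd,
    H.id_coinvConv_antipode, H.unit_coinvConv, H.coinvConv_unit]

/-- The conjugate `S'` of the antipode by `f ▷ _` is again a graded right convolution inverse of the
identity, as product, coproduct, unit and counit are equivariant; cancellation gives `S' = S_R`. -/
theorem isMor_coinvAntipode : YDModule.IsMor H.coinvYD H.coinvYD H.coinvAntipode where
  map_proj := H.antipode_mem_gradedEnd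
  map_act f := by
    let A := LinearEquiv.ofInjectiveEndo (H.coinvYD.act f) (H.coinvYD_act_injective f)
    have hA : ∀ X, A X = H.coinvYD.act f X := fun _ => rfl
    let S' : H.coinv →ₗ[k] H.coinv := A.symm.toLinearMap ∘ₗ H.coinvAntipode ∘ₗ A.toLinearMap
    have hS' : ∀ X, H.coinvYD.act f (S' X) = H.coinvAntipode (H.coinvYD.act f X) :=
      fun X => A.apply_symm_apply _
    have hmem : S' ∈ H.gradedEnd := by
      intro g X
      apply H.coinvYD_act_injective f
      rw [hS', ← H.coinvYD.proj_act, ← H.coinvYD.proj_act, hS', H.antipode_mem_gradedEnd]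
    have hconv : H.coinvConv LinearMap.id S' = H.coinvConv LinearMap.id H.coinvAntipode := by
      rw [H.id_coinvConv_antipode]
      ext X : 1
      apply H.coinvYD_act_injective f
      -- The scalar of the diagonal action depends only on degrees, which `S'` preserves.
      have h1 : H.coinvYD.tensorAct H.coinvYD f ∘ₗ TensorProduct.map LinearMap.id S' =
          TensorProduct.map LinearMap.id H.coinvAntipode ∘ₗ H.coinvYD.tensorAct H.coinvYD f := by
        refine H.coinvYD.ext_tmul H.coinvYD fun x y X Y hX hY => ?_
        simp only [LinearMap.comp_apply, TensorProduct.map_tmul, LinearMap.id_apply, map_smul,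
          YDModule.tensorAct_tmul hX hY,
          YDModule.tensorAct_tmul hX (isHom_of_mem_gradedEnd hmem hY), hS']
      have h2 := LinearMap.congr_fun h1 (H.coinvComul X)
      have h3 := LinearMap.congr_fun H.id_coinvConv_antipode (H.coinvYD.act f X)
      rw [H.isMor_unit.map_act] at h3
      rw [← h3]
      simp only [coinvConv, LinearMap.comp_apply] at h2 ⊢
      rw [← H.isMor_coinvMul.map_act, H.isMor_coinvComul.map_act]
      exact congrArg H.coinvMul h2
    intro X
    rw [← hS', id_coinvConv_cancel hmem H.antipode_mem_gradedEnd hconv]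

end
end GradedPointedMajidAlgebra
end Majid

/-! ### Homogeneous presentations of the comultiplication and the Hopf algebra object -/

section Majid
open Coalgebra
namespace GradedPointedMajidAlgebra

section
variable {k M : Type u} {G : Type w} [Field k] [NonAssocRing M] [Module k M]
    [IsScalarTower k M M] [SMulCommClass k M M] [Coalgebra k M] [CommGroup G]
    (H : GradedPointedMajidAlgebra k M G)

/-- `t` is a sum of tensors `X₁ ⊗ X₂` of bihomogeneous elements in which the right degree of `X₁`
is the left degree of `X₂`, and the right degree of `X₂` is `1`. -/
def HasHomRep (t : M ⊗[k] M) : Prop :=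
  ∃ (n : ℕ) (X₁ X₂ : Fin n → M) (x₁ x₂ : Fin n → G), t = ∑ i, X₁ i ⊗ₜ[k] X₂ i ∧
    (∀ i, H.IsBi (x₁ i * x₂ i) (x₂ i) (X₁ i)) ∧ ∀ i, H.IsBi (x₂ i) 1 (X₂ i)

variable {H} in
theorem HasHomRep.add {s t : M ⊗[k] M} (hs : H.HasHomRep s) (ht : H.HasHomRep t) :
    H.HasHomRep (s + t) := by
  obtain ⟨n, X₁, X₂, x₁, x₂, rfl, h1, h2⟩ := hs
  obtain ⟨m, Y₁, Y₂, y₁, y₂, rfl, h3, h4⟩ := ht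
  refine ⟨n + m, Fin.append X₁ Y₁, Fin.append X₂ Y₂, Fin.append x₁ y₁, Fin.append x₂ y₂,
    by simp [Fin.sum_univ_add], fun i => ?_, fun i => ?_⟩
  · induction i using Fin.addCases <;> simp [h1, h3]
  · induction i using Fin.addCases <;> simp [h2, h4]

theorem hasHomRep_zero : H.HasHomRep 0 :=
  ⟨0, Fin.elim0, Fin.elim0, Fin.elim0, Fin.elim0, by simp, Fin.rec0, Fin.rec0⟩

variable [Fintype G] [DecidableEq G]

/-- Splitting both factors into homogeneous parts suffices: `A · b ⊗ B` already has the required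
degrees. Applied to the comultiplication of `R`, this shows that the presentations in the
proposition exist. -/
theorem hasHomRep_unstrip (t : H.coinv ⊗[k] H.coinv) : H.HasHomRep (H.unstrip t) := by
  induction t using TensorProduct.induction_on with
  | zero => simpa using H.hasHomRep_zero
  | tmul A B =>
    rw [← H.coinvYD.sum_proj A, TensorProduct.sum_tmul, map_sum]
    refine Finset.sum_induction _ H.HasHomRep (fun _ _ => HasHomRep.add) H.hasHomRep_zero
      fun a _ => ?_
    rw [← H.coinvYD.sum_proj B, TensorProduct.tmul_sum, map_sum]
    refine Finset.sum_induction _ H.HasHomRep (fun _ _ => HasHomRep.add) H.hasHomRep_zero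
      fun b _ => ?_
    have hA := H.coinvYD_isHom.1 (H.coinvYD.isHom_proj a A)
    have hB := H.coinvYD_isHom.1 (H.coinvYD.isHom_proj b B)
    refine ⟨1, fun _ => (H.coinvYD.proj a A : M) * H.of b, fun _ => (H.coinvYD.proj b B : M),
      fun _ => a, fun _ => b, ?_, fun _ => ?_, fun _ => hB⟩
    · rw [hB.unstrip_tmul, Fin.sum_univ_one]
    · simpa using hA.mul (H.isBi_of b)
  | add s t hs ht =>
    rw [map_add]
    exact hs.add ht

theorem exists_isHomRep (X : H.coinv) : ∃ (n : ℕ) (X₁ X₂ : Fin n → M) (x₁ x₂ : Fin n → G),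
    H.IsHomRep X X₁ X₂ x₁ x₂ := by
  obtain ⟨n, X₁, X₂, x₁, x₂, h, h1, h2⟩ := H.hasHomRep_unstrip (H.coinvComul X)
  exact ⟨n, X₁, X₂, x₁, x₂, by rw [← h, H.unstrip_coinvComul], fun i => H.mem_biComp.2 (h1 i),
    fun i => H.mem_biComp.2 (h2 i)⟩

variable {H} in
-- The comultiplication of `R` is `strip ⊗ strip` after `Δ`, so it can be evaluated termwise on any
-- presentation; independence of the choice is automatic.
theorem IsHomRep.map_coinvComul {X : H.coinv} {n : ℕ} {X₁ X₂ : Fin n → M} {x₁ x₂ : Fin n → G}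
    (h : H.IsHomRep X X₁ X₂ x₁ x₂) :
    TensorProduct.map H.coinv.subtype H.coinv.subtype (H.coinvComul X) =
      ∑ i, (H.cocycle (x₁ i) (x₂ i) (x₂ i)⁻¹ : k) • ((X₁ i * H.of (x₂ i)⁻¹) ⊗ₜ[k] X₂ i) := by
  rw [coinvComul, LinearMap.comp_apply, LinearMap.comp_apply, Submodule.subtype_apply, h.comul_eq,
    map_sum, map_sum]
  refine Finset.sum_congr rfl fun i _ => ?_
  have h1 := (H.mem_biComp.1 (h.left i)).strip_eq
  rw [mul_inv_cancel_right] at h1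
  simp only [TensorProduct.map_tmul, Submodule.subtype_apply, coe_toCoinv, h1,
    (H.mem_biComp.1 (h.right i)).strip_self, TensorProduct.smul_tmul']

variable [FiniteDimensional k M]

/-- The Hopf algebra `R` in the Yetter-Drinfeld category. -/
noncomputable abbrev coinvHopf : HopfObj (YD.mk (φ := H.cocycle) H.coinv H.coinvYD) where
  one := ⟨H.coinvOne, H.isMor_coinvOne⟩
  mul := ⟨H.coinvMul, H.isMor_coinvMul⟩
  one_mul := YD.hom_ext <| TensorProduct.ext' fun a X => Subtype.ext <| by
    change (a • (1 : M)) * (X : M) = a • (X : M)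
    rw [smul_mul_assoc, one_mul]
  mul_one := YD.hom_ext <| TensorProduct.ext' fun X a => Subtype.ext <| by
    change (X : M) * (a • (1 : M)) = a • (X : M)
    rw [mul_smul_comm, mul_one]
  mul_assoc := YD.hom_ext H.coinvMul_assoc
  counit := ⟨H.coinvCounit, H.isMor_coinvCounit⟩
  comul := ⟨H.coinvComul, H.isMor_coinvComul⟩
  counit_comul := YD.hom_ext <| LinearMap.ext fun X => by
    change H.coinvCounit.rTensor H.coinv (H.coinvComul X) = (TensorProduct.lid k H.coinv).symm X
    rw [LinearEquiv.eq_symm_apply, H.lid_rTensor_coinvCounit]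
  comul_counit := YD.hom_ext <| LinearMap.ext fun X => by
    change H.coinvCounit.lTensor H.coinv (H.coinvComul X) = (TensorProduct.rid k H.coinv).symm X
    rw [LinearEquiv.eq_symm_apply, H.rid_lTensor_coinvCounit]
  comul_assoc := YD.hom_ext H.coinvComul_coassoc
  mul_comul := YD.hom_ext H.coinvComul_mul
  one_comul := YD.hom_ext <| LinearMap.ext_ring <| by
    change H.coinvComul (H.coinvOne 1) = TensorProduct.map H.coinvOne H.coinvOne
      ((TensorProduct.lid k k).symm 1)
    rw [H.coinvComul_one]
    simp
  mul_counit := YD.hom_ext <| TensorProduct.ext' fun X Y => by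
    change counit (R := k) ((X : M) * (Y : M)) =
      TensorProduct.lid k k (TensorProduct.map H.coinvCounit H.coinvCounit (X ⊗ₜ Y))
    simp [H.counit_mul_eq]
  one_counit := YD.hom_ext <| LinearMap.ext_ring <| by
    change counit (R := k) ((1 : k) • (1 : M)) = 1
    rw [one_smul, H.one_groupLike.counit_eq_one]
  antipode := ⟨H.coinvAntipode, H.isMor_coinvAntipode⟩
  antipode_left := YD.hom_ext H.antipode_coinvConv_id
  antipode_right := YD.hom_ext H.id_coinvConv_antipode

end
end GradedPointedMajidAlgebra
end Majid

theorem proposition3p2 {k M : Type u} {G : Type w} [Field k] [IsAlgClosed k] [CharZero k]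
    [CommGroup G] [Fintype G] [DecidableEq G] [NonAssocRing M] [Module k M]
    [IsScalarTower k M M] [SMulCommClass k M M] [Coalgebra k M] [FiniteDimensional k M]
    (H : GradedPointedMajidAlgebra k M G) :
    -- `R` is an object of the Yetter-Drinfeld category, with `R_g = ᵍM¹` and
    -- `f ▷ X = Φ(fg, f⁻¹, f) / Φ(f, f⁻¹, f) (f · X) · f⁻¹` for `X ∈ R_g`
    ∃ Y : YDModule H.cocycle H.coinv,
      (∀ (g : G) (X : H.coinv), Y.IsHom g X ↔ (X : M) ∈ H.biComp g 1) ∧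
      (∀ (f g : G) (X : H.coinv), Y.IsHom g X →
        (Y.act f X : M) = ((H.cocycle (f * g) f⁻¹ f / H.cocycle f f⁻¹ f : kˣ) : k) •
          ((H.of f * (X : M)) * H.of f⁻¹)) ∧
      -- and it is a Hopf algebra in this braided category, in which
      ∃ B : HopfObj (YD.mk (φ := H.cocycle) H.coinv Y),
        -- the multiplication and the unit are inherited from `M`
        (∀ X X' : H.coinv, ((B.mul.lin (X ⊗ₜ[k] X') : H.coinv) : M) = (X : M) * (X' : M)) ∧
        ((B.one.lin (1 : k) : H.coinv) : M) = 1 ∧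
        -- the comultiplication is `X ↦ Φ(x₁, x₂, x₂⁻¹) X₁ · x₂⁻¹ ⊗ X₂`
        (∀ X : H.coinv,
          (∃ (n : ℕ) (X₁ X₂ : Fin n → M) (x₁ x₂ : Fin n → G), H.IsHomRep X X₁ X₂ x₁ x₂) ∧
          ∀ (n : ℕ) (X₁ X₂ : Fin n → M) (x₁ x₂ : Fin n → G), H.IsHomRep X X₁ X₂ x₁ x₂ →
            TensorProduct.map H.coinv.subtype H.coinv.subtype (B.comul.lin X) =
              ∑ i, (H.cocycle (x₁ i) (x₂ i) (x₂ i)⁻¹ : k) •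
                ((X₁ i * H.of (x₂ i)⁻¹) ⊗ₜ[k] X₂ i)) ∧
        -- the counit is the restriction of the counit of `M`
        (∀ X : H.coinv, (B.counit.lin X : k) = Coalgebra.counit (R := k) (X : M)) ∧
        -- the antipode is `X ↦ Φ(x, x⁻¹, x)⁻¹ x · S(X)` for `X` of degree `x`
        (∀ (x : G) (X : H.coinv), Y.IsHom x X →
          ((B.antipode.lin X : H.coinv) : M) =
            (((H.cocycle x x⁻¹ x)⁻¹ : kˣ) : k) • (H.of x * H.S (X : M))) := by
  refine ⟨H.coinvYD, fun g X => H.coinvYD_isHom.trans H.mem_biComp.symm,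
    fun f g X hX => (H.coinvYD_isHom.1 hX).act_eq f, H.coinvHopf, fun _ _ => rfl, ?_,
    fun X => ⟨H.exists_isHomRep X, fun n X₁ X₂ x₁ x₂ h => h.map_coinvComul⟩, fun _ => rfl,
    fun x X hX => (H.coinvYD_isHom.1 hX).coe_coinvAntipode⟩
  exact one_smul k (1 : M)
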